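/- Let $(W,S)$ be an arbitrary Coxeter system with identity $e$, length $\ell$, Bruhat order $\le$ and covering relation $\lhd$ ($u\lhd v$ iff $u^{-1}v$ is a reflection and $\ell(v)=\ell(u)+1$). For $J\subseteq S$ let $W_J$ be the subgroup generated by $J$, and let $W^J$ (resp. ${}^JW$) be the set of elements with no right (resp. left) descent in $J$; write $w=w^J w_J$ and $w={}_Jw\,{}^Jw$ for the unique factorizations with $w^J\in W^J$, ${}^Jw\in{}^JW$ and $w_J,{}_Jw\in W_J$. Let $\mathrm{Supp}_H(w)=\{s\in H: s\le w\}$, let $w_0(H)$ be the longest element of $[e,w]\cap W_H$, and let $C_s$ be the set of generators commuting with $s$. A matching of $[e,x]$ is an involution $M$ of $[e,x]$ with $u\lhd M(u)$ or $M(u)\lhd u$ for all $u$; it is a multiplication matching if it is left or right multiplication by some fixed generator. $\lambda_\alpha$ and $\rho_\alpha$ denote left and right multiplication by $\alpha\in S$; $M$ commutes with $\lambda_\alpha$ (on $[e,x]$) if $M(\alpha u)=\alpha M(u)$ whenever $u,\alpha u\le x$, and similarly for $\rho_\alpha$. A system for $w\in W$ is a triple $\mathcal S=(J,H,M)$ with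 $H\subseteq S$, $|H|\in\{1,2\}$, $M$ a matching of $[e,w_0(H)]$ and $C_{M(e)}\subseteq J\subseteq S$ such that, with $K=(S\setminus J)\cup C_{M(e)}$: * $M$ is a multiplication matching if and only if $|H|=1$; * $w^J\in W_K$; * $|\mathrm{Supp}_H((w^J)^H)|\le1$, and $M$ commutes with $\lambda_\alpha$ for every $\alpha$ in this set; $|\mathrm{Supp}_H({}^H({}^Kw))|\le 1$, and $M$ commutes with $\rho_\beta$ for every $\beta$ in this set. An $\mathcal S$-factorization of $u\in W$ is a factorization $u=a\cdot b\cdot c$ with $\ell(u)=\ell(a)+\ell(b)+\ell(c)$ such that * $a\in W_K\cap W^H$, $|\mathrm{Supp}_H(a)|\le1$, and $M$ commutes with $\lambda_\alpha$ for $\alpha\in\mathrm{Supp}_H(a)$; * $b\in W_H$; * $c\in W_J\cap{}^HW$, $|\mathrm{Supp}_H(c)|\le1$, and $M$ commutes with $\rho_\beta$ for $\beta\in\mathrm{Supp}_H(c)$. $\mathcal S$ is of the first kind if $H\subseteq K$, and of the second kind if $H\subseteq J$. For a system of the first kind put $a_{\mathcal S}(u)=(u^J)^H$, $b_{\mathcal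 S}(u)=(u^J)_H\,{}_H(u_J)$, $c_{\mathcal S}(u)={}^H(u_J)$, $$W_{\mathcal S}=\{u\in W: u_0(H)\le w_0(H),\ a_{\mathcal S}(u)\le a_{\mathcal S}(w)\},\qquad M_{\mathcal S}(u)=a_{\mathcal S}(u)\,M(b_{\mathcal S}(u))\,c_{\mathcal S}(u).$$ For a system of the second kind put $a'_{\mathcal S}(u)=({}_Ku)^H$, $b'_{\mathcal S}(u)=({}_Ku)_H\,{}_H({}^Ku)$, $c'_{\mathcal S}(u)={}^H({}^Ku)$, $$W'_{\mathcal S}=\{u\in W: u_0(H)\le w_0(H),\ c'_{\mathcal S}(u)\le c'_{\mathcal S}(w)\},\qquad M_{\mathcal S}(u)=a'_{\mathcal S}(u)\,M(b'_{\mathcal S}(u))\,c'_{\mathcal S}(u).$$ **Theorem.** Let $\mathcal S=(J,H,M)$ be a system for $w$. Then $\mathcal S$ is of the first or of the second kind. Let $u\le w$ or, more generally, $u\in W_{\mathcal S}$ if $\mathcal S$ is of the first kind, $u\in W'_{\mathcal S}$ if $\mathcal S$ is of the second kind (if $\mathcal S$ is of both kinds, the statement holds for each of the two definitions of $M_{\mathcal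 S}$). If $u=a\cdot b\cdot c$ is any $\mathcal S$-factorization of $u$, then $$M_{\mathcal S}(u)=a\,M(b)\,c$$ (so $a\,M(b)\,c$ does not depend on the chosen $\mathcal S$-factorization), $u\lhd M_{\mathcal S}(u)$ if and only if $b\lhd M(b)$, and $a\cdot M(b)\cdot c$ is an $\mathcal S$-factorization of $M_{\mathcal S}(u)$. -/

import Mathlib

namespace CoxeterSystem

variable {B W : Type*} [Group W] {A : CoxeterMatrix B} (cs : CoxeterSystem A W)

/-! ### Bruhat order -/

/-- The covering relation `u ◁ v` of the Bruhat order: `u⁻¹ v` is a reflection and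
`ℓ(v) = ℓ(u) + 1`. -/
def BruhatCov (u v : W) : Prop :=
  cs.IsReflection (u⁻¹ * v) ∧ cs.length v = cs.length u + 1

/-- The Bruhat order: the reflexive transitive closure of its covering relation. -/
def BruhatLE (u v : W) : Prop := Relation.ReflTransGen cs.BruhatCov u v

theorem BruhatLE.length_le {u v : W} (h : cs.BruhatLE u v) : cs.length u ≤ cs.length v := by
  unfold BruhatLE at h
  induction h with
  | refl => exact le_rfl
  | tail _ h ih => exact ih.trans (by rw [h.2]; exact Nat.le_succ _)

theorem one_bruhatLE (w : W) : cs.BruhatLE 1 w := by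
  unfold BruhatLE
  induction hn : cs.length w generalizing w with
  | zero => rw [cs.length_eq_zero_iff.mp hn]
  | succ n ih =>
    have hw : w ≠ 1 := by rintro rfl; simp at hn
    obtain ⟨i, hi⟩ := cs.exists_rightDescent_of_ne_one hw
    rw [cs.isRightDescent_iff] at hi
    refine (ih (w * cs.simple i) (by omega)).tail ⟨?_, hi.symm⟩
    have : (w * cs.simple i)⁻¹ * w = cs.simple i := by simp
    rw [this]
    exact cs.isReflection_simple i

/-- The support `{s ∈ S : s ≤ w}`; generators are indexed by `B`. -/
def supp (w : W) : Set B := {i | cs.BruhatLE (cs.simple i) w}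

/-! ### Parabolic subgroups and minimal coset representatives -/

/-- The parabolic subgroup `W_J`. -/
def parabolic (J : Set B) : Subgroup W := Subgroup.closure (cs.simple '' J)

/-- `W^J`: the elements with no right descent in `J`. -/
def minRight (J : Set B) : Set W := {w | ∀ i ∈ J, ¬ cs.IsRightDescent w i}

/-- `^J W`: the elements with no left descent in `J`. -/
def minLeft (J : Set B) : Set W := {w | ∀ i ∈ J, ¬ cs.IsLeftDescent w i}

theorem exists_minRight (J : Set B) (w : W) :
    ∃ x, x ∈ cs.minRight J ∧ x⁻¹ * w ∈ cs.parabolic J := by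
  classical
  have hex : ∃ n, ∃ x, x⁻¹ * w ∈ cs.parabolic J ∧ cs.length x = n :=
    ⟨_, w, by simp, rfl⟩
  obtain ⟨x, hx, hn⟩ := Nat.find_spec hex
  refine ⟨x, fun i hi hd => ?_, hx⟩
  refine Nat.find_min hex (m := cs.length (x * cs.simple i)) (by rw [← hn]; exact hd)
    ⟨x * cs.simple i, ?_, rfl⟩
  have hs : cs.simple i ∈ cs.parabolic J := Subgroup.subset_closure ⟨i, hi, rfl⟩
  have h := (cs.parabolic J).mul_mem hs hx
  simpa [mul_assoc] using h

/-- `w^J`: the factor in `W^J` of the factorization `w = w^J w_J` (which is unique). -/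
noncomputable def upperR (J : Set B) (w : W) : W := (cs.exists_minRight J w).choose

/-- `w_J`: the factor in `W_J` of the factorization `w = w^J w_J`. -/
noncomputable def lowerR (J : Set B) (w : W) : W := (cs.upperR J w)⁻¹ * w

/-- `^J w`: the factor in `^J W` of the factorization `w = _J w ^J w`. -/
noncomputable def upperL (J : Set B) (w : W) : W := (cs.upperR J w⁻¹)⁻¹

/-- `_J w`: the factor in `W_J` of the factorization `w = _J w ^J w`. -/
noncomputable def lowerL (J : Set B) (w : W) : W := (cs.lowerR J w⁻¹)⁻¹

theorem upperR_mem (J : Set B) (w : W) : cs.upperR J w ∈ cs.minRight J :=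
  (cs.exists_minRight J w).choose_spec.1

theorem lowerR_mem (J : Set B) (w : W) : cs.lowerR J w ∈ cs.parabolic J :=
  (cs.exists_minRight J w).choose_spec.2

theorem upperR_mul_lowerR (J : Set B) (w : W) : cs.upperR J w * cs.lowerR J w = w := by
  simp [lowerR]

theorem upperL_mem (J : Set B) (w : W) : cs.upperL J w ∈ cs.minLeft J := by
  intro i hi h
  rw [upperL, cs.isLeftDescent_inv_iff] at h
  exact cs.upperR_mem J w⁻¹ i hi h

theorem lowerL_mem (J : Set B) (w : W) : cs.lowerL J w ∈ cs.parabolic J :=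
  (cs.parabolic J).inv_mem (cs.lowerR_mem J w⁻¹)

theorem lowerL_mul_upperL (J : Set B) (w : W) : cs.lowerL J w * cs.upperL J w = w := by
  rw [lowerL, upperL, ← mul_inv_rev, upperR_mul_lowerR, inv_inv]

theorem exists_longest (H : Set B) (w : W) :
    ∃ x, (x ∈ cs.parabolic H ∧ cs.BruhatLE x w) ∧
      ∀ y, y ∈ cs.parabolic H → cs.BruhatLE y w → cs.length y ≤ cs.length x := by
  classical
  let P : ℕ → Prop := fun n => ∃ x, (x ∈ cs.parabolic H ∧ cs.BruhatLE x w) ∧ cs.length x = n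
  have h0 : P 0 := ⟨1, ⟨(cs.parabolic H).one_mem, cs.one_bruhatLE w⟩, cs.length_one⟩
  obtain ⟨x, hx, hn⟩ := Nat.findGreatest_spec (P := P) (Nat.zero_le (cs.length w)) h0
  refine ⟨x, hx, fun y hy hyw => ?_⟩
  rw [hn]
  exact Nat.le_findGreatest (BruhatLE.length_le cs hyw) ⟨y, ⟨hy, hyw⟩, rfl⟩

/-- `w_0(H)`: the longest element of `[e, w] ∩ W_H` (which is unique). -/
noncomputable def longestIn (H : Set B) (w : W) : W := (cs.exists_longest H w).choose

/-! ### Matchings of lower intervals -/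

/-- `M` restricts to a matching of the Hasse diagram of `[e, x]`. The values of `M` outside
`[e, x]` are irrelevant. -/
def IsMatching (x : W) (M : W → W) : Prop :=
  ∀ u, cs.BruhatLE u x →
    cs.BruhatLE (M u) x ∧ M (M u) = u ∧ (cs.BruhatCov u (M u) ∨ cs.BruhatCov (M u) u)

/-- On `[e, x]`, `M` is left or right multiplication by a generator. -/
def IsMultiplicationOn (x : W) (M : W → W) : Prop :=
  ∃ i, (∀ u, cs.BruhatLE u x → M u = cs.simple i * u) ∨
    (∀ u, cs.BruhatLE u x → M u = u * cs.simple i)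

/-- On `[e, x]`, `M` commutes with left multiplication by the generator `i`. The condition
`s_i u ≤ x` holds for all `u ≤ x` as soon as `i` is a left descent of `x`. -/
def CommutesLeft (x : W) (M : W → W) (i : B) : Prop :=
  ∀ u, cs.BruhatLE u x → cs.BruhatLE (cs.simple i * u) x →
    M (cs.simple i * u) = cs.simple i * M u

/-- On `[e, x]`, `M` commutes with right multiplication by the generator `i`. -/
def CommutesRight (x : W) (M : W → W) (i : B) : Prop :=
  ∀ u, cs.BruhatLE u x → cs.BruhatLE (u * cs.simple i) x →
    M (u * cs.simple i) = M u * cs.simple i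

/-- `C_g`: the generators commuting with `g`. -/
def commutant (g : W) : Set B := {i | g * cs.simple i = cs.simple i * g}

/-- If `C_g ⊆ J`, the unique `K` with `J ∪ K = S` and `J ∩ K = C_g`. -/
def complement (g : W) (J : Set B) : Set B := Jᶜ ∪ cs.commutant g

theorem complement_spec {g : W} {J : Set B} (h : cs.commutant g ⊆ J) (K : Set B) :
    K = cs.complement g J ↔ J ∪ K = Set.univ ∧ J ∩ K = cs.commutant g := by
  simp only [complement, Set.ext_iff, Set.mem_union, Set.mem_inter_iff, Set.mem_compl_iff,
    Set.mem_univ, iff_true]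
  constructor
  · intro hK
    refine ⟨fun x => ?_, fun x => ?_⟩
    · rw [hK]; tauto
    · rw [hK]; have := @h x; tauto
  · rintro ⟨h1, h2⟩ x
    have := h1 x; have := h2 x; have := @h x; tauto

/-! ### Systems -/

/-- A system `(J, H, M)` for `w`. -/
structure MSystem (w : W) where
  J : Set B
  H : Set B
  M : W → W
  card_H : H.encard = 1 ∨ H.encard = 2
  isMatching : cs.IsMatching (cs.longestIn H w) M
  commutant_subset : cs.commutant (M 1) ⊆ J
  mult_iff : cs.IsMultiplicationOn (cs.longestIn H w) M ↔ H.encard = 1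
  upper_mem : cs.upperR J w ∈ cs.parabolic (cs.complement (M 1) J)
  left_card : (cs.supp (cs.upperR H (cs.upperR J w)) ∩ H).encard ≤ 1
  left_comm : ∀ i ∈ cs.supp (cs.upperR H (cs.upperR J w)) ∩ H,
    cs.CommutesLeft (cs.longestIn H w) M i
  right_card :
    (cs.supp (cs.upperL H (cs.upperL (cs.complement (M 1) J) w)) ∩ H).encard ≤ 1
  right_comm : ∀ i ∈ cs.supp (cs.upperL H (cs.upperL (cs.complement (M 1) J) w)) ∩ H,
    cs.CommutesRight (cs.longestIn H w) M i

namespace MSystem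

variable {cs} {w : W} (S : cs.MSystem w)

/-- The `M(e)`-complement of `J`. -/
def K : Set B := cs.complement (S.M 1) S.J

/-- `u = a · b · c` is an `S`-factorization of `u`. -/
structure IsFactorization (u a b c : W) : Prop where
  eq : u = a * b * c
  length_eq : cs.length u = cs.length a + cs.length b + cs.length c
  a_mem : a ∈ cs.parabolic S.K
  a_min : a ∈ cs.minRight S.H
  a_card : (cs.supp a ∩ S.H).encard ≤ 1
  a_comm : ∀ i ∈ cs.supp a ∩ S.H, cs.CommutesLeft (cs.longestIn S.H w) S.M i
  b_mem : b ∈ cs.parabolic S.H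
  c_mem : c ∈ cs.parabolic S.J
  c_min : c ∈ cs.minLeft S.H
  c_card : (cs.supp c ∩ S.H).encard ≤ 1
  c_comm : ∀ i ∈ cs.supp c ∩ S.H, cs.CommutesRight (cs.longestIn S.H w) S.M i

def IsFirstKind : Prop := S.H ⊆ S.K

def IsSecondKind : Prop := S.H ⊆ S.J

/-- `a_S(u) = (u^J)^H` -/
noncomputable def a₁ (u : W) : W := cs.upperR S.H (cs.upperR S.J u)

/-- `b_S(u) = (u^J)_H · _H(u_J)` -/
noncomputable def b₁ (u : W) : W :=
  cs.lowerR S.H (cs.upperR S.J u) * cs.lowerL S.H (cs.lowerR S.J u)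

/-- `c_S(u) = ^H(u_J)` -/
noncomputable def c₁ (u : W) : W := cs.upperL S.H (cs.lowerR S.J u)

/-- The set `W_S` (for systems of the first kind). -/
def domain₁ : Set W :=
  {u | cs.BruhatLE (cs.longestIn S.H u) (cs.longestIn S.H w) ∧ cs.BruhatLE (S.a₁ u) (S.a₁ w)}

/-- The map `M_S` of a system of the first kind. -/
noncomputable def map₁ (u : W) : W := S.a₁ u * S.M (S.b₁ u) * S.c₁ u

/-- `a'_S(u) = (_K u)^H` -/
noncomputable def a₂ (u : W) : W := cs.upperR S.H (cs.lowerL S.K u)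

/-- `b'_S(u) = (_K u)_H · _H(^K u)` -/
noncomputable def b₂ (u : W) : W :=
  cs.lowerR S.H (cs.lowerL S.K u) * cs.lowerL S.H (cs.upperL S.K u)

/-- `c'_S(u) = ^H(^K u)` -/
noncomputable def c₂ (u : W) : W := cs.upperL S.H (cs.upperL S.K u)

/-- The set `W'_S` (for systems of the second kind). -/
def domain₂ : Set W :=
  {u | cs.BruhatLE (cs.longestIn S.H u) (cs.longestIn S.H w) ∧ cs.BruhatLE (S.c₂ u) (S.c₂ w)}

/-- The map `M_S` of a system of the second kind. -/
noncomputable def map₂ (u : W) : W := S.a₂ u * S.M (S.b₂ u) * S.c₂ u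

end MSystem

end CoxeterSystem

/-! Put `s = M(e)`. Inverting all elements exchanges `J` and `K`, so the second kind reduces to the
first. There `H = {s, t}` lies in `K` and meets `J` only in `s` (with `t = s` when `|H| = 1`), while
`J ∩ K = C_s`.

Given `u = a b c`, write `a b = q g` with `q ∈ W^J` and `g ∈ W_J`. Since `a b ∈ W_K`, the factor `g`
lies in `W_{C_s}`, where `s` is central, so `g = e y` with `e ∈ {1, s}` and `y ∈ W_{C_s \ s}`. As `y
c` has no left descent in `H`, the factorization defining `M_S(u)` is read off from `q · e · (y c)`.
With `q = a₁ b₁` split along `H`, one has `a b = a₁ (b₁ e) y`, and the claim becomes `a M(b) = a₁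
M(b₁ e) y`. It is proved one letter `j` of `y` at a time (`mul_map_of_mul_simple`). Either `j`
commutes with the `W_H`-part and its image under `M` and slides into the left factor, or `t` is in
the support of the left factor. In the latter case `M` commutes with `λ_t`, hence is right
multiplication by `s` on the elements concerned, and `s` commutes with `j`.

The other assertions reduce to additivity of lengths in `a M(b) c`. This follows from
`mul_upperR_map_mem_minRight`: after a factor in `{1, s}` is split off, `a₁ M(b₁ e)` stays in `W^J`.

The general facts on Coxeter groups rest on the reflection cocycle `invParity`, which yields strong
exchange, minimal coset representatives and the lifting property, and on the injectivity of
`simple`. -/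

namespace CoxeterSystem

variable {B W : Type*} [Group W] {A : CoxeterMatrix B} (cs : CoxeterSystem A W)

/-! ### The geometric representation separates the generators -/

section Geometric

variable (A) in
/-- The simple coroot of index `i`, in the basis of the simple roots. -/
noncomputable def geomCoroot (i : B) : Module.Dual ℝ (B →₀ ℝ) :=
  Finsupp.linearCombination ℝ (fun j => -2 * Real.cos (Real.pi / A i j))

theorem geomCoroot_single (i j : B) :
    geomCoroot A i (Finsupp.single j 1) = -2 * Real.cos (Real.pi / A i j) := by
  simp [geomCoroot]

theorem geomCoroot_self (i : B) : geomCoroot A i (Finsupp.single i 1) = 2 := by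
  simp [geomCoroot_single]

variable (A) in
/-- The simple reflection of index `i` in the geometric representation. -/
noncomputable def geomReflection (i : B) : (B →₀ ℝ) ≃ₗ[ℝ] (B →₀ ℝ) :=
  Module.reflection (geomCoroot_self (A := A) i)

/-- The product of two simple reflections acts as a rotation of angle `θ = 2π/m`. Its powers are
combinations of Chebyshev polynomials `S` at `2 cos θ`, and `S_n(2 cos θ) sin θ = sin((n + 1)θ)`
makes the relevant combinations vanish for the `m`-th power. -/
theorem geomReflection_liftable : A.IsLiftable (geomReflection A) := by
  classical
  intro i j
  by_cases hij : i = j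
  · subst hij
    rw [A.diagonal, pow_one]
    exact LinearEquiv.ext fun v => Module.involutive_reflection (geomCoroot_self (A := A) i) v
  rcases Nat.eq_zero_or_pos (A i j) with h0 | hpos
  · rw [h0, pow_zero]
  have h1 : A i j ≠ 1 := A.off_diagonal i j hij
  set m := A i j with hm
  set θ : ℝ := 2 * (Real.pi / m) with hθ
  have hm0 : (m : ℝ) ≠ 0 := by exact_mod_cast hpos.ne'
  have hmθ : (m : ℝ) * θ = 2 * Real.pi := by rw [hθ]; field_simp
  apply LinearEquiv.toLinearMap_injective
  have hfy : geomCoroot A i (Finsupp.single j 1) = -2 * Real.cos (Real.pi / m) := by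
    rw [geomCoroot_single]
  have hgx : geomCoroot A j (Finsupp.single i 1) = -2 * Real.cos (Real.pi / m) := by
    rw [geomCoroot_single, A.symmetric]
  have ht : 2 * Real.cos θ = geomCoroot A i (Finsupp.single j 1) *
      geomCoroot A j (Finsupp.single i 1) - 2 := by
    rw [hfy, hgx, hθ, Real.cos_two_mul]; ring
  unfold geomReflection
  rw [Module.reflection_mul_reflection_pow (geomCoroot_self (A := A) i)
    (geomCoroot_self (A := A) j) m _ ht]
  -- For `m = 2` the angle is `π` and `sin θ = 0` cannot be divided out.
  rcases eq_or_ne m 2 with h2 | h2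
  · have hc : Real.cos (Real.pi / m) = 0 := by rw [h2]; norm_num
    have hc' : 2 * Real.cos θ = -2 := by rw [ht, hfy, hgx, hc]; norm_num
    rw [hfy, hgx, hc, hc', h2]
    ext v : 2
    simp
    norm_num
    abel
  have h3 : (3 : ℝ) ≤ m := by
    have : 3 ≤ m := by omega
    exact_mod_cast this
  have hsin : Real.sin θ ≠ 0 := by
    apply ne_of_gt
    have hp := Real.pi_pos
    apply Real.sin_pos_of_pos_of_lt_pi
    · positivity
    · rw [hθ]
      have : 2 * (Real.pi / m) = 2 * Real.pi / m := by ring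
      rw [this, div_lt_iff₀ (by linarith)]
      nlinarith
  have hS (n : ℤ) (h : Real.sin ((n + 1) * θ) = 0) :
      (Polynomial.Chebyshev.S ℝ n).eval (2 * Real.cos θ) = 0 := by
    have := Polynomial.Chebyshev.S_two_mul_real_cos (θ := θ) n
    rw [h] at this
    exact (mul_eq_zero.mp this).resolve_right hsin
  rcases Nat.even_or_odd' m with ⟨k, hk | hk⟩
  · have hz : (Polynomial.Chebyshev.S ℝ ((k : ℤ) - 1)).eval (2 * Real.cos θ) = 0 := by
      apply hS
      have : ((((k : ℤ) - 1 : ℤ) : ℝ) + 1) * θ = Real.pi := by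
        push_cast
        rw [hk] at hmθ
        push_cast at hmθ
        linarith
      rw [this, Real.sin_pi]
    have e1 : ((m : ℤ) - 2) / 2 = (k : ℤ) - 1 := by omega
    have e2 : ((m : ℤ) - 1) / 2 = (k : ℤ) - 1 := by omega
    rw [e1, e2, hz]
    ext v : 2
    simp
  · have hz : (Polynomial.Chebyshev.S ℝ (k : ℤ)).eval (2 * Real.cos θ) +
        (Polynomial.Chebyshev.S ℝ ((k : ℤ) - 1)).eval (2 * Real.cos θ) = 0 := by
      have a1 := Polynomial.Chebyshev.S_two_mul_real_cos (θ := θ) (k : ℤ)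
      have a2 := Polynomial.Chebyshev.S_two_mul_real_cos (θ := θ) ((k : ℤ) - 1)
      have : Real.sin ((((k : ℤ) : ℝ) + 1) * θ) +
          Real.sin (((((k : ℤ) - 1 : ℤ) : ℝ) + 1) * θ) = 0 := by
        -- For `m = 2k + 1` the angles `(k + 1)θ` and `kθ` add up to `mθ = 2π`, so their sines are
        -- opposite.
        have e : (((k : ℤ) : ℝ) + 1) * θ = 2 * Real.pi - (((k : ℤ) - 1 : ℤ) + 1 : ℝ) * θ := by
          rw [← hmθ, hk]; push_cast; ring
        rw [e, Real.sin_two_pi_sub]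
        ring
      rw [← a1, ← a2, ← add_mul] at this
      exact (mul_eq_zero.mp this).resolve_right hsin
    have e1 : ((m : ℤ) - 2) / 2 = (k : ℤ) - 1 := by omega
    have e2 : ((m : ℤ) - 1) / 2 = (k : ℤ) := by omega
    have e3 : ((m : ℤ) - 3) / 2 = (k : ℤ) - 1 := by omega
    have e4 : (m : ℤ) / 2 = (k : ℤ) := by omega
    rw [e1, e2, e3, e4, hz]
    ext v : 2
    simp

-- The reflection of index `i` negates the basis vector at `i`, whereas one of index `j ≠ i` changes
-- only the `j`-th coordinate.
include cs in
theorem simple_injective : Function.Injective cs.simple := by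
  classical
  intro i j h
  by_contra hij
  have h2 : geomReflection A i = geomReflection A j := by
    rw [← cs.lift_apply_simple geomReflection_liftable i, h,
      cs.lift_apply_simple geomReflection_liftable j]
  have h3 := congrArg (fun f : (B →₀ ℝ) ≃ₗ[ℝ] (B →₀ ℝ) => f (Finsupp.single i 1) i) h2
  simp [geomReflection, Module.reflection_apply, geomCoroot_single, hij] at h3
  norm_num at h3

end Geometric

/-! ### The reflection cocycle and the strong exchange property -/

section Cocycle

open scoped Classical in
/-- The action of the generator `i` on `W × ℤ/2` by conjugation on the first factor, which changes
the sign at `s_i`. -/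
noncomputable def signedConj (i : B) : Equiv.Perm (W × ZMod 2) where
  toFun p := (cs.simple i * p.1 * cs.simple i, p.2 + if p.1 = cs.simple i then 1 else 0)
  invFun p := (cs.simple i * p.1 * cs.simple i, p.2 + if p.1 = cs.simple i then 1 else 0)
  left_inv p := by
    have h : cs.simple i * p.1 * cs.simple i = cs.simple i ↔ p.1 = cs.simple i := by
      constructor
      · intro h
        have := congrArg (fun x => cs.simple i * x * cs.simple i) h
        simpa [mul_assoc] using this
      · intro h; simp [h]
    ext
    · simp [mul_assoc]
    · simp only [h]
      split_ifs <;> simp [add_assoc]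
      rfl
  right_inv p := by
    have h : cs.simple i * p.1 * cs.simple i = cs.simple i ↔ p.1 = cs.simple i := by
      constructor
      · intro h
        have := congrArg (fun x => cs.simple i * x * cs.simple i) h
        simpa [mul_assoc] using this
      · intro h; simp [h]
    ext
    · simp [mul_assoc]
    · simp only [h]
      split_ifs <;> simp [add_assoc]
      rfl

open scoped Classical in
theorem signedConj_apply (i : B) (p : W × ZMod 2) : cs.signedConj i p =
    (cs.simple i * p.1 * cs.simple i, p.2 + if p.1 = cs.simple i then 1 else 0) := rfl

-- The sign changes once for each of the `2n` reflections met by the alternating word of length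
-- `2n`, counted with multiplicity.
open scoped Classical in
theorem signedConj_mul_pow_apply (i j : B) (n : ℕ) (p : W × ZMod 2) :
    ((cs.signedConj i * cs.signedConj j) ^ n) p =
      ((cs.simple i * cs.simple j) ^ n * p.1 * ((cs.simple i * cs.simple j) ^ n)⁻¹,
        p.2 + ∑ l ∈ Finset.range (2 * n),
          if p.1 = cs.simple j * (cs.simple i * cs.simple j) ^ l then 1 else 0) := by
  set r := cs.simple i * cs.simple j with hr
  have hjr : cs.simple j * r = r⁻¹ * cs.simple j := by
    simp [hr, mul_assoc]
  have hjrn (n : ℕ) : cs.simple j * r ^ n = (r ^ n)⁻¹ * cs.simple j := by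
    induction n with
    | zero => simp
    | succ n ih =>
      rw [pow_succ, ← mul_assoc, ih, mul_assoc, hjr, ← mul_assoc, ← mul_inv_rev, ← pow_succ',
        ← pow_succ]
  induction n with
  | zero => simp
  | succ n ih =>
    rw [pow_succ', Equiv.Perm.mul_apply, ih, Equiv.Perm.mul_apply, signedConj_apply,
      signedConj_apply]
    have hc1 : r ^ n * p.1 * (r ^ n)⁻¹ = cs.simple j ↔ p.1 = cs.simple j * r ^ (2 * n) := by
      rw [two_mul, pow_add, ← mul_assoc, hjrn, mul_inv_eq_iff_eq_mul, ← eq_inv_mul_iff_mul_eq,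
        mul_assoc]
    have hc2 : cs.simple j * (r ^ n * p.1 * (r ^ n)⁻¹) * cs.simple j = cs.simple i ↔
        p.1 = cs.simple j * r ^ (2 * n + 1) := by
      have e : cs.simple j * r ^ (2 * n + 1) =
          (r ^ n)⁻¹ * (cs.simple j * cs.simple i * cs.simple j) * r ^ n := by
        rw [two_mul, add_assoc, pow_add, ← mul_assoc, hjrn, pow_succ', mul_assoc (r ^ n)⁻¹,
          ← mul_assoc (cs.simple j), hr]
        simp [mul_assoc]
      rw [e]
      constructor
      · intro h
        rw [← h]
        simp [mul_assoc]
      · intro h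
        rw [h]
        simp [mul_assoc]
    ext
    · simp [hr, pow_succ', mul_assoc]
    · simp only [hc1, hc2]
      rw [show 2 * (n + 1) = 2 * n + 1 + 1 by ring, Finset.sum_range_succ, Finset.sum_range_succ]
      ring

/-- The `2m` reflections in the sign repeat with period `m`, so each is counted an even number of
times. -/
theorem signedConj_liftable : A.IsLiftable cs.signedConj := by
  classical
  intro i j
  ext1 p
  rw [signedConj_mul_pow_apply, cs.simple_mul_simple_pow, two_mul, Finset.sum_range_add]
  have h (l : ℕ) : (cs.simple i * cs.simple j) ^ (A i j + l) =
      (cs.simple i * cs.simple j) ^ l := by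
    rw [pow_add, cs.simple_mul_simple_pow, one_mul]
  simp only [h, CharTwo.add_self_eq_zero]
  simp

/-- The action of `W` on `W × ℤ/2`. -/
noncomputable def signedConjHom : W →* Equiv.Perm (W × ZMod 2) :=
  cs.lift ⟨cs.signedConj, cs.signedConj_liftable⟩

/-- The reflection cocycle: the parity of the number of occurrences of `t` in the right inversion
sequence of a word for `w`. -/
noncomputable def invParity (w t : W) : ZMod 2 := (cs.signedConjHom w (t, 0)).2

open scoped Classical in
theorem signedConjHom_simple_apply (i : B) (p : W × ZMod 2) : cs.signedConjHom (cs.simple i) p =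
    (cs.simple i * p.1 * cs.simple i, p.2 + if p.1 = cs.simple i then 1 else 0) := by
  rw [signedConjHom, lift_apply_simple, signedConj_apply]

theorem signedConjHom_apply (w t : W) (ε : ZMod 2) :
    cs.signedConjHom w (t, ε) = (w * t * w⁻¹, ε + cs.invParity w t) := by
  classical
  induction w using cs.simple_induction_left generalizing t ε with
  | one => simp [invParity]
  | mul_simple_left w i ih =>
    simp only [invParity, map_mul, Equiv.Perm.mul_apply]
    rw [ih, ih, signedConjHom_simple_apply, signedConjHom_simple_apply]
    ext
    · simp [mul_assoc]
    · simp only [zero_add]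
      ring

theorem invParity_mul (u v t : W) :
    cs.invParity (u * v) t = cs.invParity v t + cs.invParity u (v * t * v⁻¹) := by
  conv_lhs => rw [invParity, map_mul, Equiv.Perm.mul_apply, signedConjHom_apply,
    signedConjHom_apply]
  simp

theorem invParity_one (t : W) : cs.invParity 1 t = 0 := by
  simp [invParity]

open scoped Classical in
theorem invParity_simple (i : B) (t : W) :
    cs.invParity (cs.simple i) t = if t = cs.simple i then 1 else 0 := by
  rw [invParity, signedConjHom_simple_apply]; simp

/-- For `t = w s w⁻¹` the contributions of `w` and `w⁻¹` cancel because `w w⁻¹ = 1`; only that of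
`s` remains. -/
theorem invParity_self {t : W} (ht : cs.IsReflection t) : cs.invParity t t = 1 := by
  obtain ⟨w, i, rfl⟩ := ht
  have h := cs.invParity_mul w w⁻¹ (w * cs.simple i * w⁻¹)
  rw [mul_inv_cancel, invParity_one] at h
  rw [invParity_mul, invParity_mul, invParity_simple]
  have e : w⁻¹ * (w * cs.simple i * w⁻¹) * w⁻¹⁻¹ = cs.simple i := by simp [mul_assoc]
  rw [e] at h ⊢
  simp only [if_true]
  have e2 : cs.simple i * cs.simple i * (cs.simple i)⁻¹ = cs.simple i := by simp
  rw [e2, ← add_assoc, add_right_comm, ← h, zero_add]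

theorem mem_rightInvSeq_of_invParity {ω : List B} {t : W}
    (h : cs.invParity (cs.wordProd ω) t = 1) : t ∈ cs.rightInvSeq ω := by
  classical
  induction ω with
  | nil => simp [invParity_one] at h
  | cons i ω ih =>
    rw [rightInvSeq]
    by_cases h1 : cs.invParity (cs.wordProd ω) t = 1
    · exact List.mem_cons_of_mem _ (ih h1)
    · rw [wordProd_cons, invParity_mul, invParity_simple] at h
      split_ifs at h with h2
      · rw [List.mem_cons, ← h2]
        left
        simp [mul_assoc]
      · rw [add_zero] at h
        exact absurd h h1

/-- Odd parity puts `t` in the inversion sequence of a reduced word. Conversely, if the parity at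
`w` is even, it is odd at `w t`, so `t` shortens `w t` and lengthens `w`. -/
theorem isRightInversion_iff_invParity {w t : W} (ht : cs.IsReflection t) :
    cs.IsRightInversion w t ↔ cs.invParity w t = 1 := by
  have key (w : W) (h : cs.invParity w t = 1) : cs.IsRightInversion w t := by
    obtain ⟨ω, hω, rfl⟩ := cs.exists_isReduced w
    exact cs.isRightInversion_of_mem_rightInvSeq hω (cs.mem_rightInvSeq_of_invParity h)
  refine ⟨fun h => ?_, key w⟩
  by_contra hne
  have h0 : cs.invParity w t = 0 := by
    revert hne; generalize cs.invParity w t = x; revert x; decide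
  refine ht.isRightInversion_mul_left_iff.mp (key (w * t) ?_) h
  rw [invParity_mul, invParity_self cs ht, mul_inv_cancel_right, h0, add_zero]

/-- An odd sum in the cocycle identity has an odd summand. -/
theorem IsRightInversion.of_mul {u v t : W} (h : cs.IsRightInversion (u * v) t) :
    cs.IsRightInversion v t ∨ cs.IsRightInversion u (v * t * v⁻¹) := by
  have ht := h.1
  rw [cs.isRightInversion_iff_invParity ht, invParity_mul] at h
  rw [cs.isRightInversion_iff_invParity ht, cs.isRightInversion_iff_invParity (ht.conj v)]
  revert h
  generalize cs.invParity v t = x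
  generalize cs.invParity u _ = y
  revert x y
  decide

/-- The strong exchange property. -/
theorem IsRightInversion.exists_eraseIdx {ω : List B} {t : W}
    (h : cs.IsRightInversion (cs.wordProd ω) t) :
    ∃ k < ω.length, cs.wordProd ω * t = cs.wordProd (ω.eraseIdx k) := by
  have := cs.mem_rightInvSeq_of_invParity ((cs.isRightInversion_iff_invParity h.1).mp h)
  obtain ⟨k, hk, rfl⟩ := List.mem_iff_getElem.mp this
  refine ⟨k, by simpa using hk, ?_⟩
  rw [← List.getD_eq_getElem _ 1 hk, wordProd_mul_getD_rightInvSeq]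

end Cocycle

/-! ### Parabolic subgroups -/

theorem simple_mem_parabolic {J : Set B} {i : B} (h : i ∈ J) : cs.simple i ∈ cs.parabolic J :=
  Subgroup.subset_closure ⟨i, h, rfl⟩

theorem parabolic_mono {I J : Set B} (h : I ⊆ J) : cs.parabolic I ≤ cs.parabolic J :=
  Subgroup.closure_mono (Set.image_mono h)

theorem wordProd_mem_parabolic {J : Set B} {ω : List B} (h : ∀ i ∈ ω, i ∈ J) :
    cs.wordProd ω ∈ cs.parabolic J := by
  induction ω with
  | nil => simp
  | cons i ω ih =>
    rw [wordProd_cons]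
    exact mul_mem (cs.simple_mem_parabolic (h i (by simp))) (ih fun k hk => h k (by simp [hk]))

theorem parabolic_induction {J : Set B} {p : W → Prop} (one : p 1)
    (mul : ∀ x ∈ cs.parabolic J, ∀ i ∈ J, p x → p (x * cs.simple i)) {x : W}
    (hx : x ∈ cs.parabolic J) : p x := by
  induction hx using Subgroup.closure_induction_right with
  | one => exact one
  | mul_right x hx y hy ih =>
    obtain ⟨i, hi, rfl⟩ := hy
    exact mul x hx i hi ih
  | mul_inv_cancel x hx y hy ih =>
    obtain ⟨i, hi, rfl⟩ := hy
    rw [inv_simple]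
    exact mul x hx i hi ih

/-- Every element of `W_J` has a reduced word with letters in `J`. -/
theorem exists_isReduced_of_mem_parabolic {J : Set B} {w : W} (h : w ∈ cs.parabolic J) :
    ∃ ω : List B, cs.IsReduced ω ∧ (∀ i ∈ ω, i ∈ J) ∧ w = cs.wordProd ω := by
  refine cs.parabolic_induction (p := fun w => ∃ ω : List B, cs.IsReduced ω ∧
    (∀ i ∈ ω, i ∈ J) ∧ w = cs.wordProd ω) ?_ ?_ h
  · exact ⟨[], by simp [IsReduced], by simp, by simp⟩
  · intro x hx i hi ih
    obtain ⟨ω, hω, hJ, rfl⟩ := ih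
    by_cases hd : cs.IsRightDescent (cs.wordProd ω) i
    · obtain ⟨k, hk, he⟩ := IsRightInversion.exists_eraseIdx cs
        ((cs.isRightInversion_simple_iff_isRightDescent _ i).mpr hd)
      refine ⟨ω.eraseIdx k, ?_, fun j hj => hJ j (List.mem_of_mem_eraseIdx hj), he⟩
      rw [IsReduced, ← he]
      have h1 := cs.isRightDescent_iff.mp hd
      have h2 := List.length_eraseIdx_add_one hk
      have h3 := hω.eq
      omega
    · refine ⟨ω ++ [i], ?_, ?_, by simp [wordProd_append]⟩
      · rw [IsReduced, wordProd_append, wordProd_singleton, cs.not_isRightDescent_iff.mp hd,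
          hω.eq]
        simp
      · intro j hj
        rcases List.mem_append.mp hj with hj | hj
        · exact hJ j hj
        · rw [List.mem_singleton.mp hj]; exact hi

theorem exists_mul_simple_of_mem_parabolic {J : Set B} {w : W} (h : w ∈ cs.parabolic J)
    (h1 : w ≠ 1) : ∃ v ∈ cs.parabolic J, ∃ i ∈ J, w = v * cs.simple i ∧
      cs.length w = cs.length v + 1 := by
  obtain ⟨ω, hω, hJ, rfl⟩ := cs.exists_isReduced_of_mem_parabolic h
  rcases List.eq_nil_or_concat' ω with rfl | ⟨ω', i, rfl⟩
  · simp at h1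
  · refine ⟨cs.wordProd ω', cs.wordProd_mem_parabolic fun j hj => hJ j (by simp [hj]), i,
      hJ i (by simp), by simp [wordProd_append], ?_⟩
    have h2 : cs.IsReduced ω' := by
      have := hω.take ω'.length
      simpa using this
    rw [hω.eq, h2.eq]
    simp

theorem simple_mem_parabolic_iff {J : Set B} {i : B} :
    cs.simple i ∈ cs.parabolic J ↔ i ∈ J := by
  refine ⟨fun h => ?_, cs.simple_mem_parabolic⟩
  have h1 : cs.simple i ≠ 1 := by
    intro h
    have := cs.length_simple i
    rw [h, cs.length_one] at this
    omega
  obtain ⟨v, -, j, hj, he, hl⟩ := cs.exists_mul_simple_of_mem_parabolic h h1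
  rw [cs.length_simple] at hl
  rw [cs.length_eq_zero_iff.mp (by omega : cs.length v = 0), one_mul] at he
  rwa [cs.simple_injective he]

/-- Right inversions of elements of `W_J` lie in `W_J`. -/
theorem IsRightInversion.mem_parabolic {J : Set B} {w t : W} (h : cs.IsRightInversion w t)
    (hw : w ∈ cs.parabolic J) : t ∈ cs.parabolic J := by
  obtain ⟨ω, hω, hJ, rfl⟩ := cs.exists_isReduced_of_mem_parabolic hw
  obtain ⟨k, hk, he⟩ := IsRightInversion.exists_eraseIdx cs h
  have := cs.wordProd_mem_parabolic (J := J) (ω := ω.eraseIdx k)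
    fun j hj => hJ j (List.mem_of_mem_eraseIdx hj)
  rw [← he] at this
  exact (Subgroup.mul_mem_cancel_left _ hw).mp this

theorem IsRightDescent.mem_of_mem_parabolic {J : Set B} {w : W} {i : B}
    (h : cs.IsRightDescent w i) (hw : w ∈ cs.parabolic J) : i ∈ J :=
  cs.simple_mem_parabolic_iff.mp (IsRightInversion.mem_parabolic cs
    ((cs.isRightInversion_simple_iff_isRightDescent w i).mpr h) hw)

theorem exists_isRightDescent_of_mem_parabolic {J : Set B} {w : W} (h : w ∈ cs.parabolic J)
    (h1 : w ≠ 1) : ∃ i ∈ J, cs.IsRightDescent w i := by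
  obtain ⟨v, -, i, hi, rfl, hl⟩ := cs.exists_mul_simple_of_mem_parabolic h h1
  refine ⟨i, hi, ?_⟩
  rw [IsRightDescent, simple_mul_simple_cancel_right]
  omega

/-! ### Minimal coset representatives -/

theorem one_mem_minRight (J : Set B) : (1 : W) ∈ cs.minRight J :=
  fun i _ => cs.not_isRightDescent_one i

theorem inv_mem_minLeft_iff {J : Set B} {w : W} : w⁻¹ ∈ cs.minLeft J ↔ w ∈ cs.minRight J := by
  simp only [minLeft, minRight, Set.mem_ofPred_eq, isLeftDescent_inv_iff]

theorem inv_mem_minRight_iff {J : Set B} {w : W} : w⁻¹ ∈ cs.minRight J ↔ w ∈ cs.minLeft J := by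
  rw [← inv_mem_minLeft_iff, inv_inv]

/-- Build `v` letter by letter. A letter that shortened `u v'` would come from an inversion of `v'`,
against reducedness, or from a reflection of `W_J` shortening `u` inside its coset. -/
theorem length_mul_of_forall_le {J : Set B} {u v : W}
    (hu : ∀ g ∈ cs.parabolic J, cs.length u ≤ cs.length (u * g)) (hv : v ∈ cs.parabolic J) :
    cs.length (u * v) = cs.length u + cs.length v := by
  induction hn : cs.length v generalizing v with
  | zero => rw [cs.length_eq_zero_iff.mp hn]; simp
  | succ n ih =>
    have h1 : v ≠ 1 := by rintro rfl; simp at hn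
    obtain ⟨v', hv', i, hi, rfl, hl⟩ := cs.exists_mul_simple_of_mem_parabolic hv h1
    have ih' := ih hv' (by omega)
    rw [← mul_assoc]
    have hnd : ¬ cs.IsRightDescent (u * v') i := by
      intro hd
      rw [← isRightInversion_simple_iff_isRightDescent] at hd
      rcases IsRightInversion.of_mul cs hd with h | h
      · have := h.2
        omega
      · have h3 : v' * cs.simple i * v'⁻¹ ∈ cs.parabolic J :=
          mul_mem (mul_mem hv' (cs.simple_mem_parabolic hi)) (inv_mem hv')
        exact absurd h.2 (not_lt.mpr (hu _ h3))
    rw [cs.not_isRightDescent_iff.mp hnd, ih']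
    omega

/-- Let `u g` be shortest in the coset. If `g ≠ 1`, lengths add in `u = (u g) g⁻¹`, so a right
descent of `g⁻¹` in `J` is one of `u`. -/
theorem length_le_length_mul_of_mem_minRight {J : Set B} {u : W} (hu : u ∈ cs.minRight J) :
    ∀ g ∈ cs.parabolic J, cs.length u ≤ cs.length (u * g) := by
  classical
  have hex : ∃ n, ∃ g ∈ cs.parabolic J, cs.length (u * g) = n := ⟨_, 1, one_mem _, rfl⟩
  obtain ⟨g, hg, hn⟩ := Nat.find_spec hex
  have hmin : ∀ k ∈ cs.parabolic J, cs.length (u * g) ≤ cs.length (u * g * k) := by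
    intro k hk
    rw [hn]
    exact Nat.find_min' hex ⟨g * k, mul_mem hg hk, by rw [mul_assoc]⟩
  have h1 : g = 1 := by
    by_contra h1
    obtain ⟨i, hi, hd⟩ := cs.exists_isRightDescent_of_mem_parabolic (inv_mem hg) (inv_ne_one.mpr h1)
    refine hu i hi ?_
    have e1 := cs.length_mul_of_forall_le hmin (inv_mem hg)
    have e2 := cs.length_mul_of_forall_le hmin
      (mul_mem (inv_mem hg) (cs.simple_mem_parabolic hi))
    rw [← mul_assoc] at e2
    rw [mul_inv_cancel_right] at e1 e2
    rw [IsRightDescent] at hd ⊢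
    omega
  simpa [h1] using hmin

theorem length_mul_of_mem_minRight {J : Set B} {u v : W} (hu : u ∈ cs.minRight J)
    (hv : v ∈ cs.parabolic J) : cs.length (u * v) = cs.length u + cs.length v :=
  cs.length_mul_of_forall_le (cs.length_le_length_mul_of_mem_minRight hu) hv

theorem length_mul_of_mem_minLeft {J : Set B} {u v : W} (hu : u ∈ cs.parabolic J)
    (hv : v ∈ cs.minLeft J) : cs.length (u * v) = cs.length u + cs.length v := by
  have := cs.length_mul_of_mem_minRight (cs.inv_mem_minRight_iff.mpr hv) (inv_mem hu)
  rw [← mul_inv_rev, length_inv, length_inv, length_inv] at this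
  omega

theorem minRight_mul_parabolic_unique {J : Set B} {u v u' v' : W} (hu : u ∈ cs.minRight J)
    (hv : v ∈ cs.parabolic J) (hu' : u' ∈ cs.minRight J) (hv' : v' ∈ cs.parabolic J)
    (h : u * v = u' * v') : u = u' ∧ v = v' := by
  have e : u = u' * (v' * v⁻¹) := by rw [← mul_assoc, ← h, mul_inv_cancel_right]
  have hg : v' * v⁻¹ ∈ cs.parabolic J := mul_mem hv' (inv_mem hv)
  have h1 := cs.length_mul_of_mem_minRight hu' hg
  have h2 := cs.length_mul_of_mem_minRight hu (inv_mem hg)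
  rw [← e] at h1
  nth_rewrite 1 [e] at h2
  rw [mul_inv_cancel_right, length_inv] at h2
  have h3 : v' * v⁻¹ = 1 := cs.length_eq_zero_iff.mp (by omega)
  rw [h3, mul_one] at e
  exact ⟨e, (mul_inv_eq_one.mp h3).symm⟩

theorem upperR_mul {J : Set B} {u v : W} (hu : u ∈ cs.minRight J) (hv : v ∈ cs.parabolic J) :
    cs.upperR J (u * v) = u :=
  (cs.minRight_mul_parabolic_unique (cs.upperR_mem J _) (cs.lowerR_mem J _) hu hv
    (cs.upperR_mul_lowerR J _)).1

theorem upperR_mul_right {J : Set B} (u : W) {v : W} (hv : v ∈ cs.parabolic J) :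
    cs.upperR J (u * v) = cs.upperR J u := by
  have := cs.upperR_mul (cs.upperR_mem J u) (mul_mem (cs.lowerR_mem J u) hv)
  rwa [← mul_assoc, upperR_mul_lowerR] at this

theorem lowerR_mul {J : Set B} {u v : W} (hu : u ∈ cs.minRight J) (hv : v ∈ cs.parabolic J) :
    cs.lowerR J (u * v) = v := by
  rw [lowerR, cs.upperR_mul hu hv, inv_mul_cancel_left]

theorem upperR_eq_self {J : Set B} {u : W} (hu : u ∈ cs.minRight J) : cs.upperR J u = u := by
  simpa using cs.upperR_mul hu (one_mem (cs.parabolic J))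

theorem upperL_mul {J : Set B} {u v : W} (hu : u ∈ cs.parabolic J) (hv : v ∈ cs.minLeft J) :
    cs.upperL J (u * v) = v := by
  rw [upperL, mul_inv_rev, cs.upperR_mul (cs.inv_mem_minRight_iff.mpr hv) (inv_mem hu), inv_inv]

theorem lowerL_mul {J : Set B} {u v : W} (hu : u ∈ cs.parabolic J) (hv : v ∈ cs.minLeft J) :
    cs.lowerL J (u * v) = u := by
  rw [lowerL, mul_inv_rev, cs.lowerR_mul (cs.inv_mem_minRight_iff.mpr hv) (inv_mem hu), inv_inv]

theorem mem_minRight_of_disjoint {I J : Set B} (h : Disjoint I J) {w : W}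
    (hw : w ∈ cs.parabolic I) : w ∈ cs.minRight J :=
  fun _ hi hd => h.notMem_of_mem_right hi (IsRightDescent.mem_of_mem_parabolic cs hd hw)

theorem length_simple_mul_simple {i j : B} (h : i ≠ j) :
    cs.length (cs.simple i * cs.simple j) = 2 := by
  have := cs.length_mul_of_mem_minRight
    (cs.mem_minRight_of_disjoint (Set.disjoint_singleton.mpr h)
      (cs.simple_mem_parabolic (Set.mem_singleton i)))
    (cs.simple_mem_parabolic (Set.mem_singleton j))
  simpa using this

theorem length_mul_simple_mul_simple {u : W} {i j : B} (h : i ≠ j)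
    (hi : ¬ cs.IsRightDescent u i) (hj : ¬ cs.IsRightDescent u j) :
    cs.length (u * cs.simple i * cs.simple j) = cs.length u + 2 := by
  have hu : u ∈ cs.minRight {i, j} := by
    rintro k (rfl | rfl)
    · exact hi
    · exact hj
  rw [mul_assoc, cs.length_mul_of_mem_minRight hu, cs.length_simple_mul_simple h]
  exact mul_mem (cs.simple_mem_parabolic (by simp)) (cs.simple_mem_parabolic (by simp))

/-- Otherwise the exchange property deletes a letter of `s_i s_j`: deleting the first makes the
generators commute, deleting the second makes them equal. -/
theorem length_simple_mul_simple_mul_simple {i j : B}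
    (h : cs.simple i * cs.simple j ≠ cs.simple j * cs.simple i) :
    cs.length (cs.simple i * cs.simple j * cs.simple i) = 3 := by
  have hij : i ≠ j := by rintro rfl; exact h rfl
  have h2 := cs.length_simple_mul_simple hij
  rcases cs.length_mul_simple (cs.simple i * cs.simple j) i with h3 | h3
  · omega
  · exfalso
    have h1 : cs.length (cs.simple i * cs.simple j * cs.simple i) = 1 := by omega
    obtain ⟨k, hk⟩ := cs.length_eq_one_iff.mp h1
    have hinv : cs.IsRightInversion (cs.wordProd [i, j]) (cs.simple i) := by
      rw [isRightInversion_simple_iff_isRightDescent, IsRightDescent]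
      simp only [wordProd_cons, wordProd_nil, mul_one]
      omega
    obtain ⟨l, hl, he⟩ := IsRightInversion.exists_eraseIdx cs hinv
    have hl' : l = 0 ∨ l = 1 := by simp at hl; omega
    rcases hl' with rfl | rfl
    · simp [wordProd_cons] at he
      exact h (by simpa using congrArg (· * cs.simple i) he)
    · simp [wordProd_cons, mul_assoc] at he
      exact hij (cs.simple_injective (mul_eq_one_iff_eq_inv.mp he |>.trans (cs.inv_simple _))).symm

/-! ### The Bruhat order -/

theorem bruhatLE_rfl {u : W} : cs.BruhatLE u u := Relation.ReflTransGen.refl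

variable {cs} in
theorem BruhatLE.trans {u v w : W} (h : cs.BruhatLE u v) (h' : cs.BruhatLE v w) :
    cs.BruhatLE u w := Relation.ReflTransGen.trans h h'

variable {cs} in
theorem BruhatCov.le {u v : W} (h : cs.BruhatCov u v) : cs.BruhatLE u v :=
  Relation.ReflTransGen.single h

theorem BruhatLE.eq_of_length_le {u v : W} (h : cs.BruhatLE u v)
    (hl : cs.length v ≤ cs.length u) : u = v := by
  rcases Relation.ReflTransGen.cases_tail h with h | ⟨x, hx, hc⟩
  · exact h.symm
  · have := BruhatLE.length_le cs hx
    have := hc.2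
    omega

variable {cs} in
theorem BruhatCov.inv {u v : W} (h : cs.BruhatCov u v) : cs.BruhatCov u⁻¹ v⁻¹ := by
  refine ⟨?_, by simpa using h.2⟩
  have h1 := h.1.conj u
  have h2 := h1.isReflection_inv
  simpa [mul_assoc] using h2

variable {cs} in
theorem BruhatLE.inv {u v : W} (h : cs.BruhatLE u v) : cs.BruhatLE u⁻¹ v⁻¹ := by
  unfold BruhatLE at h
  induction h with
  | refl => exact bruhatLE_rfl cs
  | tail _ h ih => exact ih.trans h.inv.le

theorem bruhatLE_inv_iff {u v : W} : cs.BruhatLE u⁻¹ v⁻¹ ↔ cs.BruhatLE u v :=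
  ⟨fun h => by simpa using h.inv, fun h => h.inv⟩

theorem bruhatCov_mul_simple {u : W} {i : B} (h : ¬ cs.IsRightDescent u i) :
    cs.BruhatCov u (u * cs.simple i) :=
  ⟨by simpa using cs.isReflection_simple i, cs.not_isRightDescent_iff.mp h⟩

theorem mul_simple_bruhatCov {u : W} {i : B} (h : cs.IsRightDescent u i) :
    cs.BruhatCov (u * cs.simple i) u := by
  refine ⟨by simpa [mul_assoc] using cs.isReflection_simple i, (cs.isRightDescent_iff.mp h).symm⟩

theorem bruhatLE_mul_right {u v : W} (h : cs.length (u * v) = cs.length u + cs.length v) :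
    cs.BruhatLE u (u * v) := by
  induction hn : cs.length v generalizing v with
  | zero => rw [cs.length_eq_zero_iff.mp hn, mul_one]; exact bruhatLE_rfl cs
  | succ n ih =>
    have h1 : v ≠ 1 := by rintro rfl; simp at hn
    obtain ⟨i, hi⟩ := cs.exists_rightDescent_of_ne_one h1
    have hl := cs.isRightDescent_iff.mp hi
    have h2 := cs.length_mul_le u (v * cs.simple i)
    rw [← mul_assoc] at h2
    have h3 := cs.length_mul_simple (u * v) i
    have hd : cs.IsRightDescent (u * v) i := by
      rw [isRightDescent_iff]; omega
    refine (ih (v := v * cs.simple i) ?_ (by omega)).trans ?_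
    · rw [← mul_assoc]; omega
    · rw [← mul_assoc]; exact (cs.mul_simple_bruhatCov hd).le

theorem bruhatLE_mul_left {u v : W} (h : cs.length (u * v) = cs.length u + cs.length v) :
    cs.BruhatLE v (u * v) := by
  rw [← bruhatLE_inv_iff, mul_inv_rev]
  apply bruhatLE_mul_right
  rw [← mul_inv_rev, length_inv, length_inv, length_inv]
  omega

/-- Each covering is multiplication by an inversion of the larger element, and such inversions lie
in `W_J`. -/
theorem BruhatLE.mem_parabolic {J : Set B} {u v : W} (h : cs.BruhatLE u v)
    (hv : v ∈ cs.parabolic J) : u ∈ cs.parabolic J := by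
  unfold BruhatLE at h
  induction h with
  | refl => exact hv
  | tail _ h ih =>
    rename_i x y _
    apply ih
    have hr : cs.IsRightInversion y (x⁻¹ * y) := by
      refine ⟨h.1, ?_⟩
      have e : y * (x⁻¹ * y) = x := by
        have := h.1.inv
        rw [← this]; simp
      rw [e, h.2]
      omega
    have := IsRightInversion.mem_parabolic cs hr hv
    have := mul_mem hv (inv_mem this)
    simpa using this

theorem simple_bruhatLE_of_mem {ω : List B} (hω : cs.IsReduced ω) {i : B} (hi : i ∈ ω) :
    cs.BruhatLE (cs.simple i) (cs.wordProd ω) := by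
  obtain ⟨l₁, l₂, rfl⟩ := List.append_of_mem hi
  have h1 : cs.IsReduced (i :: l₂) := by simpa using hω.drop l₁.length
  have h2 : cs.IsReduced l₂ := by simpa using h1.drop 1
  have h3 : cs.IsReduced l₁ := by simpa using hω.take l₁.length
  rw [wordProd_append]
  refine BruhatLE.trans ?_ (cs.bruhatLE_mul_left ?_)
  · rw [wordProd_cons]
    apply bruhatLE_mul_right
    rw [← wordProd_cons, h1.eq, h2.eq, length_simple]
    simp [add_comm]
  · rw [← wordProd_append, hω.eq, h3.eq, h1.eq]
    simp

theorem mem_parabolic_iff_supp_subset {J : Set B} {w : W} :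
    w ∈ cs.parabolic J ↔ cs.supp w ⊆ J := by
  constructor
  · intro h i hi
    exact cs.simple_mem_parabolic_iff.mp (BruhatLE.mem_parabolic cs hi h)
  · intro h
    obtain ⟨ω, hω, rfl⟩ := cs.exists_isReduced w
    exact cs.wordProd_mem_parabolic fun i hi => h (cs.simple_bruhatLE_of_mem hω hi)

theorem mem_parabolic_inter {I J : Set B} {w : W} (hI : w ∈ cs.parabolic I)
    (hJ : w ∈ cs.parabolic J) : w ∈ cs.parabolic (I ∩ J) := by
  rw [mem_parabolic_iff_supp_subset] at *
  exact Set.subset_inter hI hJ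

theorem mem_parabolic_compl_singleton {w : W} {i : B} (h : i ∉ cs.supp w) :
    w ∈ cs.parabolic {i}ᶜ := by
  rw [mem_parabolic_iff_supp_subset]
  rintro j hj rfl
  exact h hj

variable {cs} in
theorem BruhatLE.supp_subset {u v : W} (h : cs.BruhatLE u v) : cs.supp u ⊆ cs.supp v :=
  fun _ hi => BruhatLE.trans hi h

theorem supp_inv (w : W) : cs.supp w⁻¹ = cs.supp w := by
  ext i
  simp only [supp, Set.mem_ofPred_eq]
  rw [← bruhatLE_inv_iff, inv_inv, inv_simple]

theorem supp_mul_left {u v : W} (h : cs.length (u * v) = cs.length u + cs.length v) :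
    cs.supp u ⊆ cs.supp (u * v) := (cs.bruhatLE_mul_right h).supp_subset

/-! ### The lifting property -/

/-- The core of the lifting property. If `t = u⁻¹ w` differs from `s_i`, the cocycle shows that `s_i
t s_i` is an inversion of `w s_i`, and it takes `w s_i` to `u s_i`. -/
theorem BruhatCov.length_mul_simple_lt {u w : W} {i : B} (h : cs.BruhatCov u w)
    (hne : w ≠ u * cs.simple i) :
    cs.length (u * cs.simple i) < cs.length (w * cs.simple i) := by
  classical
  set t := u⁻¹ * w with ht
  have hu : u = w * t := by
    have : t * t = 1 := h.1.mul_self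
    have e : w = u * t := by rw [ht, mul_inv_cancel_left]
    rw [e, mul_assoc, this, mul_one]
  have hti : t ≠ cs.simple i := by
    intro hti
    apply hne
    rw [← hti, ht, mul_inv_cancel_left]
  have hr : cs.IsReflection (cs.simple i * t * cs.simple i) := by
    simpa using h.1.conj (cs.simple i)
  have hw : cs.invParity w t = 1 := by
    rw [← cs.isRightInversion_iff_invParity h.1]
    refine ⟨h.1, ?_⟩
    rw [← hu, h.2]
    omega
  have key : cs.IsRightInversion (w * cs.simple i) (cs.simple i * t * cs.simple i) := by
    rw [cs.isRightInversion_iff_invParity hr, invParity_mul, invParity_simple, if_neg]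
    · simpa [mul_assoc] using hw
    · intro he
      apply hti
      have := congrArg (fun x => cs.simple i * x * cs.simple i) he
      simpa [mul_assoc] using this
  have := key.2
  rw [hu]
  simpa [mul_assoc] using this

open scoped Classical in
/-- The longer of `u` and `u s_i`. -/
noncomputable def mulUp (u : W) (i : B) : W :=
  if cs.IsRightDescent u i then u else u * cs.simple i

open scoped Classical in
/-- The shorter of `u` and `u s_i`. -/
noncomputable def mulDown (u : W) (i : B) : W :=
  if cs.IsRightDescent u i then u * cs.simple i else u

theorem bruhatLE_mulUp (u : W) (i : B) : cs.BruhatLE u (cs.mulUp u i) := by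
  unfold mulUp
  split_ifs with h
  · exact bruhatLE_rfl cs
  · exact (cs.bruhatCov_mul_simple h).le

theorem mulDown_bruhatLE (u : W) (i : B) : cs.BruhatLE (cs.mulDown u i) u := by
  unfold mulDown
  split_ifs with h
  · exact (cs.mul_simple_bruhatCov h).le
  · exact bruhatLE_rfl cs

theorem mulUp_mulDown (u : W) (i : B) : cs.mulUp (cs.mulDown u i) i = cs.mulUp u i := by
  unfold mulUp mulDown
  by_cases h : cs.IsRightDescent u i
  · have := cs.isRightDescent_iff_not_isRightDescent_mul.mp h
    simp [h, this]
  · simp [h]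

/-- If `u s_i` is longer than `u` and differs from `w`, then `length_mul_simple_lt` forces `w s_i`
to be longer than `w`, and the covering is carried to `u s_i`, `w s_i`. Monotonicity of `mulUp` and
`mulDown` serves as the lifting property. -/
theorem BruhatCov.mulUp {u w : W} (h : cs.BruhatCov u w) (i : B) :
    cs.BruhatLE (cs.mulUp u i) (cs.mulUp w i) := by
  by_cases hu : cs.IsRightDescent u i
  · refine BruhatLE.trans ?_ (cs.bruhatLE_mulUp w i)
    rw [CoxeterSystem.mulUp, if_pos hu]
    exact h.le
  · by_cases he : w = u * cs.simple i
    · rw [CoxeterSystem.mulUp, if_neg hu, ← he]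
      exact cs.bruhatLE_mulUp w i
    · have hl := BruhatCov.length_mul_simple_lt cs h he
      have hl' := cs.not_isRightDescent_iff.mp hu
      have hc := h.2
      by_cases hw : cs.IsRightDescent w i
      · have := cs.isRightDescent_iff.mp hw
        omega
      · have hw' := cs.not_isRightDescent_iff.mp hw
        rw [CoxeterSystem.mulUp, if_neg hu, CoxeterSystem.mulUp, if_neg hw]
        refine BruhatCov.le ⟨?_, by omega⟩
        have := h.1.conj (cs.simple i)
        simpa [mul_assoc] using this

theorem BruhatCov.mulDown {u w : W} (h : cs.BruhatCov u w) (i : B) :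
    cs.BruhatLE (cs.mulDown u i) (cs.mulDown w i) := by
  by_cases hw : cs.IsRightDescent w i
  · by_cases he : w = u * cs.simple i
    · rw [CoxeterSystem.mulDown.eq_1 cs w, if_pos hw, he, simple_mul_simple_cancel_right]
      exact cs.mulDown_bruhatLE u i
    · have hl := BruhatCov.length_mul_simple_lt cs h he
      have hl' := cs.isRightDescent_iff.mp hw
      have hc := h.2
      by_cases hu : cs.IsRightDescent u i
      · have := cs.isRightDescent_iff.mp hu
        rw [CoxeterSystem.mulDown, if_pos hu, CoxeterSystem.mulDown, if_pos hw]
        refine BruhatCov.le ⟨?_, by omega⟩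
        have := h.1.conj (cs.simple i)
        simpa [mul_assoc] using this
      · have := cs.not_isRightDescent_iff.mp hu
        omega
  · refine (cs.mulDown_bruhatLE u i).trans ?_
    rw [CoxeterSystem.mulDown, if_neg hw]
    exact h.le

variable {cs} in
theorem BruhatLE.mulUp {u w : W} (h : cs.BruhatLE u w) (i : B) :
    cs.BruhatLE (cs.mulUp u i) (cs.mulUp w i) := by
  unfold BruhatLE at h
  induction h with
  | refl => exact bruhatLE_rfl cs
  | tail _ h ih => exact ih.trans (BruhatCov.mulUp cs h i)

variable {cs} in
theorem BruhatLE.mulDown {u w : W} (h : cs.BruhatLE u w) (i : B) :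
    cs.BruhatLE (cs.mulDown u i) (cs.mulDown w i) := by
  unfold BruhatLE at h
  induction h with
  | refl => exact bruhatLE_rfl cs
  | tail _ h ih => exact ih.trans (BruhatCov.mulDown cs h i)

theorem upperR_bruhatLE (J : Set B) (w : W) : cs.BruhatLE (cs.upperR J w) w := by
  have h := cs.length_mul_of_mem_minRight (cs.upperR_mem J w) (cs.lowerR_mem J w)
  have := cs.bruhatLE_mul_right h
  rwa [upperR_mul_lowerR] at this

variable {cs} in
/-- The projection to minimal coset representatives is monotone. -/
theorem BruhatLE.upperR {u w : W} (h : cs.BruhatLE u w) (J : Set B) :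
    cs.BruhatLE (cs.upperR J u) (cs.upperR J w) := by
  induction hn : cs.length w using Nat.strong_induction_on generalizing u w with
  | _ n ih =>
    by_cases hw : w ∈ cs.minRight J
    · rw [cs.upperR_eq_self hw]
      exact (cs.upperR_bruhatLE J u).trans h
    · simp only [minRight, Set.mem_ofPred_eq, not_forall, not_not] at hw
      obtain ⟨i, hi, hd⟩ := hw
      have h1 := h.mulDown i
      have hl := cs.isRightDescent_iff.mp hd
      have hs := cs.simple_mem_parabolic hi
      -- `mulDown` along a generator in `J` stays in the same coset of `W_J`, so the pair can be
      -- replaced by one with a shorter upper element.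
      have e (x : W) : cs.upperR J (cs.mulDown x i) = cs.upperR J x := by
        unfold CoxeterSystem.mulDown
        split_ifs
        · exact cs.upperR_mul_right x hs
        · rfl
      have h2 : cs.length (cs.mulDown w i) < n := by
        rw [CoxeterSystem.mulDown, if_pos hd]; omega
      have := ih _ h2 h1 rfl
      rwa [e, e] at this

/-! ### The longest element of `[e, w] ∩ W_H` -/

/-- Makes `longestIn`, chosen by length alone, an upper bound in the Bruhat order. A right descent
`s_i` of `w` is removed: the greatest element for `w s_i` is raised by `mulUp` if `i ∈ H` and kept
otherwise. -/
theorem exists_greatest (H : Set B) (w : W) :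
    ∃ x, (x ∈ cs.parabolic H ∧ cs.BruhatLE x w) ∧
      ∀ y, y ∈ cs.parabolic H → cs.BruhatLE y w → cs.BruhatLE y x := by
  induction hn : cs.length w generalizing w with
  | zero =>
    rw [cs.length_eq_zero_iff.mp hn]
    exact ⟨1, ⟨one_mem _, bruhatLE_rfl cs⟩, fun y _ h => h⟩
  | succ n ih =>
    have h1 : w ≠ 1 := by rintro rfl; simp at hn
    obtain ⟨i, hd⟩ := cs.exists_rightDescent_of_ne_one h1
    have hl := cs.isRightDescent_iff.mp hd
    obtain ⟨z, ⟨hzH, hzw⟩, hz⟩ := ih (w * cs.simple i) (by omega)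
    have ew : cs.mulDown w i = w * cs.simple i := by rw [mulDown, if_pos hd]
    have eu : cs.mulUp (w * cs.simple i) i = w := by
      rw [← ew, mulUp_mulDown, mulUp, if_pos hd]
    by_cases hi : i ∈ H
    · have hs := cs.simple_mem_parabolic hi
      refine ⟨cs.mulUp z i, ⟨?_, ?_⟩, fun y hyH hyw => ?_⟩
      · unfold mulUp
        split_ifs
        · exact hzH
        · exact mul_mem hzH hs
      · have := hzw.mulUp i
        rwa [eu] at this
      · have h2 := hyw.mulDown i
        rw [ew] at h2
        have h3 := hz _ (BruhatLE.mem_parabolic cs (cs.mulDown_bruhatLE y i) hyH) h2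
        have h4 := h3.mulUp i
        rw [mulUp_mulDown] at h4
        exact (cs.bruhatLE_mulUp y i).trans h4
    · refine ⟨z, ⟨hzH, hzw.trans (cs.mul_simple_bruhatCov hd).le⟩, fun y hyH hyw => hz y hyH ?_⟩
      have h2 := hyw.mulDown i
      rwa [ew, mulDown, if_neg fun h => hi (IsRightDescent.mem_of_mem_parabolic cs h hyH)] at h2

theorem longestIn_mem (H : Set B) (w : W) : cs.longestIn H w ∈ cs.parabolic H :=
  (cs.exists_longest H w).choose_spec.1.1

theorem longestIn_bruhatLE (H : Set B) (w : W) : cs.BruhatLE (cs.longestIn H w) w :=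
  (cs.exists_longest H w).choose_spec.1.2

theorem bruhatLE_longestIn {H : Set B} {w y : W} (hy : y ∈ cs.parabolic H)
    (hyw : cs.BruhatLE y w) : cs.BruhatLE y (cs.longestIn H w) := by
  obtain ⟨x, ⟨hxH, hxw⟩, hx⟩ := cs.exists_greatest H w
  have h1 := (cs.exists_longest H w).choose_spec.2 x hxH hxw
  have h2 := hx _ (cs.longestIn_mem H w) (cs.longestIn_bruhatLE H w)
  rw [BruhatLE.eq_of_length_le cs h2 h1]
  exact hx y hy hyw

/-! ### Commuting generators -/

theorem mem_parabolic_singleton {i : B} {w : W} :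
    w ∈ cs.parabolic {i} ↔ w = 1 ∨ w = cs.simple i := by
  constructor
  · intro h
    refine cs.parabolic_induction (p := fun w => w = 1 ∨ w = cs.simple i) (Or.inl rfl) ?_ h
    rintro x - _ rfl (rfl | rfl) <;> simp
  · rintro (rfl | rfl)
    · exact one_mem _
    · exact cs.simple_mem_parabolic rfl

theorem commute_of_mem_parabolic {J : Set B} {g w : W}
    (h : ∀ i ∈ J, g * cs.simple i = cs.simple i * g) (hw : w ∈ cs.parabolic J) :
    g * w = w * g := by
  refine cs.parabolic_induction (p := fun w => g * w = w * g) (by simp) ?_ hw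
  intro x _ i hi ih
  rw [← mul_assoc, ih, mul_assoc, h i hi, mul_assoc]

theorem mem_commutant_iff {g : W} {i : B} :
    i ∈ cs.commutant g ↔ g * cs.simple i = cs.simple i * g := Iff.rfl

theorem self_mem_commutant (i : B) : i ∈ cs.commutant (cs.simple i) := by
  rw [mem_commutant_iff]

/-- `s_i` is central in `W_{C_s}`, so its occurrences can be collected at the right. -/
theorem exists_mul_of_mem_parabolic_commutant {i : B} {g : W}
    (hg : g ∈ cs.parabolic (cs.commutant (cs.simple i))) :
    ∃ y ∈ cs.parabolic (cs.commutant (cs.simple i) \ {i}), ∃ e ∈ cs.parabolic {i},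
      g = y * e := by
  refine cs.parabolic_induction (p := fun g =>
    ∃ y ∈ cs.parabolic (cs.commutant (cs.simple i) \ {i}), ∃ e ∈ cs.parabolic {i},
      g = y * e) ⟨1, one_mem _, 1, one_mem _, by simp⟩ ?_ hg
  rintro _ - k hk ⟨y, hy, e, he, rfl⟩
  by_cases hki : k = i
  · subst hki
    exact ⟨y, hy, e * cs.simple k, mul_mem he (cs.simple_mem_parabolic rfl), mul_assoc _ _ _⟩
  · refine ⟨y * cs.simple k, mul_mem hy (cs.simple_mem_parabolic ⟨hk, hki⟩), e, he, ?_⟩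
    rw [mul_assoc, mul_assoc, cs.commute_of_mem_parabolic (g := cs.simple k) (J := {i}) _ he]
    rintro _ rfl
    exact (cs.mem_commutant_iff.mp hk).symm

theorem commute_commutant {i : B} {y e : W}
    (hy : y ∈ cs.parabolic (cs.commutant (cs.simple i) \ {i})) (he : e ∈ cs.parabolic {i}) :
    y * e = e * y := by
  refine cs.commute_of_mem_parabolic ?_ he
  rintro _ rfl
  exact (cs.commute_of_mem_parabolic (fun k hk => hk.1) hy).symm

theorem IsLeftDescent.mem_of_mem_parabolic {J : Set B} {w : W} {i : B}
    (h : cs.IsLeftDescent w i) (hw : w ∈ cs.parabolic J) : i ∈ J :=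
  IsRightDescent.mem_of_mem_parabolic cs (cs.isRightDescent_inv_iff.mpr h) (inv_mem hw)

/-- Split `c = y₁ e c₂` with `y₁ e ∈ W_{C_s}` and `c₂` minimal. The central factor `e` is trivial,
as otherwise `s_i` would be a left descent of `c`; so `y c = (y y₁) c₂` with `y y₁ ∈ W_{C_s \ s}`.
-/
theorem not_isLeftDescent_commutant_mul {i : B} {y c : W}
    (hy : y ∈ cs.parabolic (cs.commutant (cs.simple i) \ {i}))
    (hc : ¬ cs.IsLeftDescent c i) : ¬ cs.IsLeftDescent (y * c) i := by
  set C := cs.commutant (cs.simple i)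
  have hiC : i ∈ C := cs.self_mem_commutant i
  have hYC : cs.parabolic (C \ {i}) ≤ cs.parabolic C := cs.parabolic_mono Set.sdiff_subset
  obtain ⟨y₁, hy₁, e, he, h₁⟩ := cs.exists_mul_of_mem_parabolic_commutant (cs.lowerL_mem C c)
  have hnd {z : W} (hz : z ∈ cs.parabolic (C \ {i})) : ¬ cs.IsLeftDescent z i :=
    fun h => (IsLeftDescent.mem_of_mem_parabolic cs h hz).2 rfl
  set c₂ := cs.upperL C c with hc₂
  have hcm : c₂ ∈ cs.minLeft C := cs.upperL_mem C c
  have hci : cs.simple i ∈ cs.parabolic C := cs.simple_mem_parabolic hiC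
  have he1 : e = 1 := by
    rcases cs.mem_parabolic_singleton.mp he with h | h
    · exact h
    · exfalso
      apply hc
      have e1 : c = cs.simple i * y₁ * c₂ := by
        rw [← h, ← cs.commute_commutant hy₁ he, ← h₁, lowerL_mul_upperL]
      have h3 := cs.not_isLeftDescent_iff.mp (hnd hy₁)
      rw [IsLeftDescent, e1, cs.length_mul_of_mem_minLeft (mul_mem hci (hYC hy₁)) hcm, h3,
        mul_assoc, simple_mul_simple_cancel_left, cs.length_mul_of_mem_minLeft (hYC hy₁) hcm]
      omega
  have hc' : c = y₁ * c₂ := by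
    rw [he1, mul_one] at h₁
    rw [← h₁, lowerL_mul_upperL]
  have hyy := mul_mem hy hy₁
  have h3 := cs.not_isLeftDescent_iff.mp (hnd hyy)
  rw [not_isLeftDescent_iff, hc', ← mul_assoc y, ← mul_assoc,
    cs.length_mul_of_mem_minLeft (mul_mem hci (hYC hyy)) hcm,
    cs.length_mul_of_mem_minLeft (hYC hyy) hcm, h3]
  omega

theorem mul_simple_mem_minRight {H : Set B} {u : W} {j : B} (hu : u ∈ cs.minRight H)
    (hj : j ∉ H) (hd : ¬ cs.IsRightDescent u j) : u * cs.simple j ∈ cs.minRight H := by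
  intro i hi h
  have hji : j ≠ i := by rintro rfl; exact hj hi
  have h1 := cs.length_mul_simple_mul_simple hji hd (hu i hi)
  have h2 := cs.not_isRightDescent_iff.mp hd
  rw [IsRightDescent] at h
  omega

/-! ### Rank two parabolic subgroups -/

section RankTwo

variable {s t j : B} {β : W}

theorem isRightDescent_of_mem_minRight_left (hβ : β ∈ cs.parabolic {s, t})
    (hs : β ∈ cs.minRight {s}) (h1 : β ≠ 1) : cs.IsRightDescent β t := by
  obtain ⟨i, rfl | rfl, hd⟩ := cs.exists_isRightDescent_of_mem_parabolic hβ h1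
  · exact absurd hd (hs i rfl)
  · exact hd

theorem mem_supp_of_isRightDescent {i : B} (h : cs.IsRightDescent β i) : i ∈ cs.supp β := by
  have := cs.isRightDescent_iff.mp h
  have := cs.bruhatLE_mul_left (u := β * cs.simple i) (v := cs.simple i)
    (by rw [simple_mul_simple_cancel_right, length_simple]; omega)
  rwa [simple_mul_simple_cancel_right] at this

theorem eq_simple_of_notMem_supp (hβ : β ∈ cs.parabolic {s, t}) (h1 : β ≠ 1)
    (hs : s ∉ cs.supp β) : β = cs.simple t := by
  have h := cs.mem_parabolic_inter hβ (cs.mem_parabolic_compl_singleton hs)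
  have h2 : β ∈ cs.parabolic {t} := by
    refine cs.parabolic_mono ?_ h
    rintro i ⟨rfl | rfl, hi⟩
    · exact absurd rfl hi
    · rfl
  exact (cs.mem_parabolic_singleton.mp h2).resolve_left h1

theorem not_isRightDescent_of_notMem {H : Set B} (hβ : β ∈ cs.parabolic H) (hj : j ∉ H) :
    ¬ cs.IsRightDescent β j := fun h => hj (IsRightDescent.mem_of_mem_parabolic cs h hβ)

/-- For `s`, use that it commutes with `j`. For `t`, write `β = β' t`: then `β'` is minimal for `{t,
j}` and `s_t s_j s_t` has length three. -/
theorem mul_simple_mem_minRight_pair (hβ : β ∈ cs.parabolic {s, t})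
    (hs : β ∈ cs.minRight {s}) (h1 : β ≠ 1) (hj : j ∉ ({s, t} : Set B))
    (hjs : cs.simple s * cs.simple j = cs.simple j * cs.simple s)
    (hjt : cs.simple t * cs.simple j ≠ cs.simple j * cs.simple t) :
    β * cs.simple j ∈ cs.minRight {s, t} := by
  have hl := cs.not_isRightDescent_iff.mp (cs.not_isRightDescent_of_notMem hβ hj)
  rintro i (rfl | rfl)
  · have h2 := cs.not_isRightDescent_iff.mp (hs i rfl)
    have h3 := cs.not_isRightDescent_iff.mp (cs.not_isRightDescent_of_notMem
      (mul_mem hβ (cs.simple_mem_parabolic (J := {i, t}) (i := i) (by simp))) hj)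
    rw [IsRightDescent, mul_assoc, ← hjs, ← mul_assoc]
    omega
  · have hd := cs.isRightDescent_of_mem_minRight_left hβ hs h1
    have hd1 := cs.isRightDescent_iff.mp hd
    have hd2 := cs.isRightDescent_iff_not_isRightDescent_mul.mp hd
    have hmem : β * cs.simple i ∈ cs.minRight {i, j} := by
      rintro k (rfl | rfl)
      · exact hd2
      · exact cs.not_isRightDescent_of_notMem
          (mul_mem hβ (cs.simple_mem_parabolic (J := {s, i}) (i := i) (by simp))) hj
    have hi : cs.simple i ∈ cs.parabolic {i, j} := cs.simple_mem_parabolic (by simp)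
    have hj' : cs.simple j ∈ cs.parabolic {i, j} := cs.simple_mem_parabolic (by simp)
    have h3 := cs.length_mul_of_mem_minRight hmem (mul_mem (mul_mem hi hj') hi)
    rw [cs.length_simple_mul_simple_mul_simple hjt] at h3
    have e : β * cs.simple i * (cs.simple i * cs.simple j * cs.simple i) =
        β * cs.simple j * cs.simple i := by simp [mul_assoc]
    rw [e] at h3
    rw [IsRightDescent]
    omega

end RankTwo

/-! ### Matchings of lower intervals of rank two, in a configuration of the first kind -/

/-- The data of a system of the first kind which do not refer to `w`: `H = {s, t}` with
`M(e) = s`, and `H ∩ J = {s}`. The case `t = s` is that of a singleton `H`. -/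
structure IsFirstKindData (J K : Set B) (s t : B) (x : W) (M : W → W) : Prop where
  inter : J ∩ K = cs.commutant (cs.simple s)
  right_mem : t ∈ K
  right_notMem : t = s ∨ t ∉ J
  isMatching : cs.IsMatching x M
  mem : x ∈ cs.parabolic {s, t}
  map_one : M 1 = cs.simple s

/-- `a` meets `H` in at most one generator, and `M` commutes with left multiplication by it. -/
def IsLeftAdmissible (H : Set B) (x : W) (M : W → W) (a : W) : Prop :=
  (cs.supp a ∩ H).encard ≤ 1 ∧ ∀ i ∈ cs.supp a ∩ H, cs.CommutesLeft x M i

variable {cs} in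
theorem IsLeftAdmissible.of_le {H : Set B} {x : W} {M : W → W} {a a' : W}
    (h : cs.IsLeftAdmissible H x M a) (hle : cs.BruhatLE a' a) :
    cs.IsLeftAdmissible H x M a' := by
  have hs : cs.supp a' ∩ H ⊆ cs.supp a ∩ H := Set.inter_subset_inter_left _ hle.supp_subset
  exact ⟨(Set.encard_le_encard hs).trans h.1, fun i hi => h.2 i (hs hi)⟩

variable {cs} in
theorem IsLeftAdmissible.eq {H : Set B} {x : W} {M : W → W} {a : W} {i k : B}
    (h : cs.IsLeftAdmissible H x M a) (hi : i ∈ cs.supp a) (hiH : i ∈ H) (hk : k ∈ cs.supp a)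
    (hkH : k ∈ H) : i = k :=
  Set.encard_le_one_iff.mp h.1 i k ⟨hi, hiH⟩ ⟨hk, hkH⟩

namespace IsFirstKindData

variable {cs} {J K : Set B} {s t : B} {x : W} {M : W → W}
  (D : cs.IsFirstKindData J K s t x M)
include D

theorem left_mem_inter : s ∈ J ∩ K := D.inter ▸ cs.self_mem_commutant s

theorem pair_subset : ({s, t} : Set B) ⊆ K := by
  rintro i (rfl | rfl)
  · exact D.left_mem_inter.2
  · exact D.right_mem

theorem notMem_pair {j : B} (hj : j ∈ J) (hjs : j ≠ s) : j ∉ ({s, t} : Set B) := by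
  rintro (rfl | rfl)
  · exact hjs rfl
  · rcases D.right_notMem with h | h
    · exact hjs h
    · exact h hj

theorem map_bruhatLE {b : W} (hb : cs.BruhatLE b x) : cs.BruhatLE (M b) x :=
  (D.isMatching b hb).1

theorem map_map {b : W} (hb : cs.BruhatLE b x) : M (M b) = b := (D.isMatching b hb).2.1

theorem map_mem {b : W} (hb : cs.BruhatLE b x) : M b ∈ cs.parabolic {s, t} :=
  BruhatLE.mem_parabolic cs (D.map_bruhatLE hb) D.mem

theorem simple_left_bruhatLE : cs.BruhatLE (cs.simple s) x := by
  rw [← D.map_one]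
  exact D.map_bruhatLE (cs.one_bruhatLE x)

theorem map_simple_left : M (cs.simple s) = 1 := by
  rw [← D.map_one]
  exact D.map_map (cs.one_bruhatLE x)

theorem map_of_mem_singleton {e : W} (he : e ∈ cs.parabolic {s}) : M e = e * cs.simple s := by
  rcases cs.mem_parabolic_singleton.mp he with rfl | rfl
  · rw [D.map_one, one_mul]
  · rw [D.map_simple_left, simple_mul_simple_self]

theorem map_mul_of_commutesLeft (hc : cs.CommutesLeft x M t) {g e : W}
    (hg : g ∈ cs.parabolic {t}) (he : e ∈ cs.parabolic {s}) (hge : cs.BruhatLE (g * e) x) :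
    M (g * e) = g * e * cs.simple s := by
  rcases cs.mem_parabolic_singleton.mp hg with rfl | rfl
  · rw [one_mul, D.map_of_mem_singleton he]
  · have hex : cs.BruhatLE e x := by
      rcases cs.mem_parabolic_singleton.mp he with rfl | rfl
      · exact cs.one_bruhatLE x
      · exact D.simple_left_bruhatLE
    rw [hc e hex hge, D.map_of_mem_singleton he, mul_assoc]

/-- Moving one generator across a factorization `a * b` with `b ∈ W_H`. -/
theorem mul_map_of_mul_simple {a₁ b₁ a₂ b₂ : W} {j : B} (ha₁ : a₁ ∈ cs.minRight {s, t})
    (hb₁ : b₁ ∈ cs.parabolic {s, t}) (ha₂ : a₂ ∈ cs.minRight {s, t})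
    (hb₂ : b₂ ∈ cs.parabolic {s, t}) (hb₁x : cs.BruhatLE b₁ x) (hb₂x : cs.BruhatLE b₂ x)
    (hj : j ∉ ({s, t} : Set B)) (hjs : j ∈ cs.commutant (cs.simple s))
    (heq : a₁ * b₁ * cs.simple j = a₂ * b₂) (hnd : ¬ cs.IsRightDescent (a₁ * b₁) j)
    (hadm : cs.IsLeftAdmissible {s, t} x M a₂) :
    a₂ * M b₂ = a₁ * M b₁ * cs.simple j := by
  rw [mem_commutant_iff] at hjs
  have hl := cs.not_isRightDescent_iff.mp hnd
  have hl₁ := cs.length_mul_of_mem_minRight ha₁ hb₁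
  -- In this case `s_j` slides into the left factor: `a₂ = a₁ s_j` and `b₂ = b₁`.
  have commuting (h1 : cs.simple j * b₁ = b₁ * cs.simple j)
      (h2 : cs.simple j * M b₁ = M b₁ * cs.simple j) :
      a₂ * M b₂ = a₁ * M b₁ * cs.simple j := by
    have hd : ¬ cs.IsRightDescent a₁ j := by
      intro hd
      have h3 := cs.length_mul_le (a₁ * cs.simple j) b₁
      rw [mul_assoc, h1, ← mul_assoc] at h3
      rw [IsRightDescent] at hd
      omega
    have hm := cs.mul_simple_mem_minRight ha₁ hj hd
    have e : a₁ * cs.simple j * b₁ = a₂ * b₂ := by rw [← heq, mul_assoc, h1, mul_assoc]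
    obtain ⟨rfl, rfl⟩ := cs.minRight_mul_parabolic_unique hm hb₁ ha₂ hb₂ e
    rw [mul_assoc, h2, mul_assoc]
  by_cases hjt : cs.simple t * cs.simple j = cs.simple j * cs.simple t
  · have hcomm : ∀ i ∈ ({s, t} : Set B), cs.simple j * cs.simple i = cs.simple i * cs.simple j := by
      rintro i (rfl | rfl)
      · exact hjs.symm
      · exact hjt.symm
    exact commuting (cs.commute_of_mem_parabolic hcomm hb₁)
      (cs.commute_of_mem_parabolic hcomm (D.map_mem hb₁x))
  have hsc : ∀ i ∈ ({s} : Set B), cs.simple j * cs.simple i = cs.simple i * cs.simple j := by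
    rintro i rfl
    exact hjs.symm
  have hts : t ≠ s := by rintro rfl; exact hjt hjs
  have hsub : cs.parabolic {s} ≤ cs.parabolic {s, t} := cs.parabolic_mono (by simp)
  set β := cs.upperR {s} b₁
  set e := cs.lowerR {s} b₁
  have he : e ∈ cs.parabolic {s} := cs.lowerR_mem _ _
  have hβs : β ∈ cs.minRight {s} := cs.upperR_mem _ _
  have hβe : β * e = b₁ := cs.upperR_mul_lowerR _ _
  have hje := cs.commute_of_mem_parabolic hsc he
  have hβ : β ∈ cs.parabolic {s, t} := by
    rw [← mul_inv_eq_of_eq_mul hβe.symm]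
    exact mul_mem hb₁ (inv_mem (hsub he))
  by_cases hβ1 : β = 1
  · have hb : b₁ ∈ cs.parabolic {s} := by rw [← hβe, hβ1, one_mul]; exact he
    refine commuting (cs.commute_of_mem_parabolic hsc hb) (cs.commute_of_mem_parabolic hsc ?_)
    rw [D.map_of_mem_singleton hb]
    exact mul_mem hb (cs.simple_mem_parabolic rfl)
  have hβj := cs.mul_simple_mem_minRight_pair hβ hβs hβ1 hj hjs hjt
  have hb₁j := cs.not_isRightDescent_iff.mp (cs.not_isRightDescent_of_notMem hb₁ hj)
  -- Projecting this relation to `W^H`, where `β s_j` already lies, gives `β s_j ≤ a₂`. So `a₂` has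
  -- `t` in its support, admissibility excludes `s`, and `β = s_t`.
  have hle : cs.BruhatLE (β * cs.simple j) (a₂ * b₂) := by
    have h1 := cs.bruhatLE_mul_right (cs.length_mul_of_mem_minRight hβj (hsub he))
    rw [mul_assoc, hje, ← mul_assoc, hβe] at h1
    have h2 : cs.BruhatLE (b₁ * cs.simple j) (a₁ * (b₁ * cs.simple j)) := by
      apply cs.bruhatLE_mul_left
      rw [← mul_assoc]
      omega
    rw [← mul_assoc, heq] at h2
    exact h1.trans h2
  have hle₂ : cs.BruhatLE (β * cs.simple j) a₂ := by
    have := hle.upperR {s, t}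
    rwa [cs.upperR_eq_self hβj, cs.upperR_mul ha₂ hb₂] at this
  have hsupp : cs.supp β ⊆ cs.supp a₂ := by
    refine (cs.supp_mul_left ?_).trans hle₂.supp_subset
    rw [length_simple]
    exact cs.not_isRightDescent_iff.mp (cs.not_isRightDescent_of_notMem hβ hj)
  have htβ := cs.mem_supp_of_isRightDescent (cs.isRightDescent_of_mem_minRight_left hβ hβs hβ1)
  have ht₂ := hsupp htβ
  have hs₂ : s ∉ cs.supp a₂ := fun h => hts (hadm.eq ht₂ (by simp) h (by simp))
  have hβt : β = cs.simple t := cs.eq_simple_of_notMem_supp hβ hβ1 fun h => hs₂ (hsupp h)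
  have hcomm := hadm.2 t ⟨ht₂, by simp⟩
  have ha₁₂ : cs.BruhatLE a₁ a₂ := by
    have := (cs.bruhatCov_mul_simple hnd).le.upperR {s, t}
    rwa [heq, cs.upperR_mul ha₁ hb₁, cs.upperR_mul ha₂ hb₂] at this
  have hM₁ : M b₁ = b₁ * cs.simple s := by
    have htt : cs.simple t ∈ cs.parabolic {t} := cs.simple_mem_parabolic rfl
    rw [← hβe, hβt] at hb₁x ⊢
    exact D.map_mul_of_commutesLeft hcomm htt he hb₁x
  have hM₂ : M b₂ = b₂ * cs.simple s := by
    -- `s` is in the support neither of `a₂` nor of `a₁ ≤ a₂`, so `b₂ e⁻¹` can be written without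
    -- it.
    have hg : b₂ * e⁻¹ ∈ cs.parabolic {t} := by
      have h1 : b₂ * e⁻¹ ∈ cs.parabolic {s}ᶜ := by
        have h2 : b₂ * e⁻¹ = a₂⁻¹ * (a₁ * cs.simple t * cs.simple j) := by
          rw [eq_inv_mul_iff_mul_eq, ← mul_assoc, ← heq, ← hβe, hβt, mul_inv_eq_iff_eq_mul]
          simp only [mul_assoc]
          rw [hje]
        rw [h2]
        have hj' : j ∈ ({s}ᶜ : Set B) := fun h => hj (Or.inl h)
        exact mul_mem (inv_mem (cs.mem_parabolic_compl_singleton hs₂))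
          (mul_mem (mul_mem (cs.mem_parabolic_compl_singleton fun h =>
            hs₂ (ha₁₂.supp_subset h)) (cs.simple_mem_parabolic hts)) (cs.simple_mem_parabolic hj'))
      refine cs.parabolic_mono ?_ (cs.mem_parabolic_inter h1 (mul_mem hb₂ (inv_mem (hsub he))))
      rintro i ⟨h3, rfl | rfl⟩
      · exact absurd rfl h3
      · rfl
    have h4 := D.map_mul_of_commutesLeft hcomm hg he
      (by rw [inv_mul_cancel_right]; exact hb₂x)
    rwa [inv_mul_cancel_right] at h4
  rw [hM₁, hM₂, ← mul_assoc, ← heq]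
  simp only [mul_assoc]
  rw [hjs]

/-- Induction on the length of `y`. The intermediate products are factored anew along `H`; their
left factors lie below `a₂` and so remain admissible. -/
theorem mul_map_of_mul_commutant {a₁ b₁ a₂ b₂ y : W} (ha₁ : a₁ ∈ cs.minRight {s, t})
    (hb₁ : b₁ ∈ cs.parabolic {s, t}) (ha₂ : a₂ ∈ cs.minRight {s, t})
    (hb₂ : b₂ ∈ cs.parabolic {s, t})
    (hy : y ∈ cs.parabolic (cs.commutant (cs.simple s) \ {s}))
    (heq : a₁ * b₁ * y = a₂ * b₂)
    (hlen : cs.length (a₁ * b₁ * y) = cs.length (a₁ * b₁) + cs.length y)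
    (hx : ∀ z ∈ cs.parabolic {s, t}, cs.BruhatLE z (a₂ * b₂) → cs.BruhatLE z x)
    (hadm : cs.IsLeftAdmissible {s, t} x M a₂) :
    a₂ * M b₂ = a₁ * M b₁ * y := by
  induction hn : cs.length y generalizing y a₂ b₂ with
  | zero =>
    rw [cs.length_eq_zero_iff.mp hn, mul_one] at heq ⊢
    obtain ⟨rfl, rfl⟩ := cs.minRight_mul_parabolic_unique ha₁ hb₁ ha₂ hb₂ heq
    rfl
  | succ n ih =>
    have h1 : y ≠ 1 := by rintro rfl; simp at hn
    obtain ⟨y', hy', j, hj, rfl, hl⟩ := cs.exists_mul_simple_of_mem_parabolic hy h1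
    have h2 := cs.length_mul_le (a₁ * b₁) y'
    have h3 := cs.length_mul_simple (a₁ * b₁ * y') j
    rw [← mul_assoc] at heq hlen
    set p := a₁ * b₁ * y' with hp
    have hnd : ¬ cs.IsRightDescent p j := by
      rw [not_isRightDescent_iff]; omega
    have hple : cs.BruhatLE p (a₂ * b₂) := heq ▸ (cs.bruhatCov_mul_simple hnd).le
    set a := cs.upperR {s, t} p
    set b := cs.lowerR {s, t} p
    have ha : a ∈ cs.minRight {s, t} := cs.upperR_mem _ _
    have hb : b ∈ cs.parabolic {s, t} := cs.lowerR_mem _ _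
    have hab : a * b = p := cs.upperR_mul_lowerR _ _
    have haa : cs.BruhatLE a a₂ := by
      have := hple.upperR {s, t}
      rwa [cs.upperR_mul ha₂ hb₂] at this
    have hbp : cs.BruhatLE b p := by
      have := cs.bruhatLE_mul_left (cs.length_mul_of_mem_minRight ha hb)
      rwa [hab] at this
    have hb₂p : cs.BruhatLE b₂ (a₂ * b₂) :=
      cs.bruhatLE_mul_left (cs.length_mul_of_mem_minRight ha₂ hb₂)
    have hIH := ih ha hb hy' hab.symm (by rw [← hp]; omega)
      (fun z hz hzp => hx z hz ((hab ▸ hzp).trans hple)) (hadm.of_le haa) (by omega)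
    have hjJ : j ∈ J := (D.inter.symm ▸ hj.1 : j ∈ J ∩ K).1
    rw [D.mul_map_of_mul_simple ha hb ha₂ hb₂ (hx b hb (hbp.trans hple)) (hx b₂ hb₂ hb₂p)
      (D.notMem_pair hjJ hj.2) hj.1 (by rw [hab, heq]) (by rwa [hab]) hadm, hIH, mul_assoc]

/-- Exhibits the `W^J`-part of the image, from which additivity of lengths is deduced. -/
theorem mul_upperR_map_mem_minRight {a b e : W} (ha : a ∈ cs.minRight {s, t})
    (haK : a ∈ cs.parabolic K) (hb : b ∈ cs.parabolic {s, t}) (hab : a * b ∈ cs.minRight J)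
    (he : e ∈ cs.parabolic {s}) (hbx : cs.BruhatLE (b * e) x)
    (hadm : cs.IsLeftAdmissible {s, t} x M a) :
    a * cs.upperR {s} (M (b * e)) ∈ cs.minRight J := by
  have hsub : cs.parabolic {s} ≤ cs.parabolic {s, t} := cs.parabolic_mono (by simp)
  have hMb := D.map_mem hbx
  set β := cs.upperR {s} (M (b * e))
  set e' := cs.lowerR {s} (M (b * e))
  have he' : e' ∈ cs.parabolic {s} := cs.lowerR_mem _ _
  have hβs : β ∈ cs.minRight {s} := cs.upperR_mem _ _
  have hβe : β * e' = M (b * e) := cs.upperR_mul_lowerR _ _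
  have hβ : β ∈ cs.parabolic {s, t} := by
    rw [← mul_inv_eq_of_eq_mul hβe.symm]
    exact mul_mem hMb (inv_mem (hsub he'))
  have hss : cs.simple s ∈ cs.parabolic {s, t} := cs.simple_mem_parabolic (by simp)
  have haβ := cs.length_mul_of_mem_minRight ha hβ
  have hlab := cs.length_mul_of_mem_minRight ha hb
  have hbs : b ∈ cs.minRight {s} := by
    rintro i rfl hd
    apply hab i D.left_mem_inter.1
    have := cs.length_mul_of_mem_minRight ha (mul_mem hb hss)
    rw [IsRightDescent] at hd ⊢
    rw [mul_assoc]
    omega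
  intro j hj hd
  by_cases hjs' : j = s
  · subst hjs'
    apply hβs j rfl
    have := cs.length_mul_of_mem_minRight ha (mul_mem hβ hss)
    rw [IsRightDescent, mul_assoc] at hd
    rw [IsRightDescent]
    omega
  have hjH := D.notMem_pair hj hjs'
  have hjK : j ∈ K := IsRightDescent.mem_of_mem_parabolic cs hd
    (mul_mem haK (cs.parabolic_mono D.pair_subset hβ))
  have hjs : cs.simple s * cs.simple j = cs.simple j * cs.simple s :=
    cs.mem_commutant_iff.mp (D.inter ▸ ⟨hj, hjK⟩)
  -- Each remaining case contradicts this, or produces a descent of `a b` in `J`.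
  have hne : β ≠ b := fun h => hab j hj (h ▸ hd)
  by_cases hβ1 : β = 1
  · have h1 : M (b * e) ∈ cs.parabolic {s} := by rw [← hβe, hβ1, one_mul]; exact he'
    have h2 : b * e = M (b * e) * cs.simple s := by
      rw [← D.map_of_mem_singleton h1, D.map_map hbx]
    have h3 : b * e = 1 * (M (b * e) * cs.simple s) := by rw [one_mul, ← h2]
    exact hne (hβ1.trans (cs.minRight_mul_parabolic_unique hbs he (cs.one_mem_minRight _)
      (mul_mem h1 (cs.simple_mem_parabolic rfl)) h3).1.symm)
  by_cases hjt : cs.simple t * cs.simple j = cs.simple j * cs.simple t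
  · have hcomm : ∀ i ∈ ({s, t} : Set B), cs.simple j * cs.simple i = cs.simple i * cs.simple j := by
      rintro i (rfl | rfl)
      · exact hjs.symm
      · exact hjt.symm
    have hda : cs.IsRightDescent a j := by
      by_contra hda
      have h1 := cs.length_mul_of_mem_minRight (cs.mul_simple_mem_minRight ha hjH hda) hβ
      have h2 := cs.not_isRightDescent_iff.mp hda
      rw [mul_assoc, cs.commute_of_mem_parabolic hcomm hβ, ← mul_assoc] at h1
      rw [IsRightDescent] at hd
      omega
    apply hab j hj
    have h1 := cs.length_mul_le (a * cs.simple j) b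
    rw [mul_assoc, cs.commute_of_mem_parabolic hcomm hb, ← mul_assoc] at h1
    rw [IsRightDescent] at hda ⊢
    omega
  have hts : t ≠ s := by rintro rfl; exact hjt hjs
  have hβj := cs.mul_simple_mem_minRight_pair hβ hβs hβ1 hjH hjs hjt
  have hβnd := cs.not_isRightDescent_of_notMem hβ hjH
  -- Since `j` is a descent of `a β` but not of `β`, the reflection `β s_j β⁻¹` is an inversion of
  -- `a`; lengths add in `(β s_j) β⁻¹`, so its support contains that of `β`.
  have hsupp : cs.supp β ⊆ cs.supp a := by
    rw [← isRightInversion_simple_iff_isRightDescent] at hd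
    rcases IsRightInversion.of_mul cs hd with h | h
    · exact absurd ((cs.isRightInversion_simple_iff_isRightDescent _ _).mp h) hβnd
    · have h1 := IsRightInversion.mem_parabolic cs h
        (cs.mem_parabolic_iff_supp_subset.mpr (subset_refl _))
      rw [mem_parabolic_iff_supp_subset] at h1
      refine Set.Subset.trans ?_ h1
      refine Set.Subset.trans (cs.supp_mul_left (v := cs.simple j) ?_) (cs.supp_mul_left ?_)
      · rw [length_simple]
        exact cs.not_isRightDescent_iff.mp hβnd
      · exact cs.length_mul_of_mem_minRight hβj (inv_mem hβ)
  have hta := hsupp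
    (cs.mem_supp_of_isRightDescent (cs.isRightDescent_of_mem_minRight_left hβ hβs hβ1))
  have hβt : β = cs.simple t := cs.eq_simple_of_notMem_supp hβ hβ1 fun h =>
    hts (hadm.eq hta (by simp) (hsupp h) (by simp))
  have hMx := D.map_bruhatLE hbx
  rw [← hβe, hβt] at hMx
  have h1 := D.map_mul_of_commutesLeft (hadm.2 t ⟨hta, by simp⟩)
    (cs.simple_mem_parabolic rfl) he' hMx
  rw [← hβt, hβe, D.map_map hbx, ← hβe, mul_assoc] at h1
  exact hne (cs.minRight_mul_parabolic_unique hbs he hβs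
    (mul_mem he' (cs.simple_mem_parabolic rfl)) h1).1.symm

/-- The value of the map attached to a system of the first kind on a factorization. -/
theorem map_eq_and_length_eq {a b c : W} (ha : a ∈ cs.minRight {s, t})
    (haK : a ∈ cs.parabolic K) (hadm : cs.IsLeftAdmissible {s, t} x M a)
    (hb : b ∈ cs.parabolic {s, t}) (hc : c ∈ cs.parabolic J) (hcH : c ∈ cs.minLeft {s, t})
    (hlen : cs.length (a * b * c) = cs.length a + cs.length b + cs.length c)
    (hx : ∀ z ∈ cs.parabolic {s, t}, cs.BruhatLE z (a * b * c) → cs.BruhatLE z x) :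
    cs.upperR {s, t} (cs.upperR J (a * b * c)) *
        M (cs.lowerR {s, t} (cs.upperR J (a * b * c)) *
          cs.lowerL {s, t} (cs.lowerR J (a * b * c))) *
        cs.upperL {s, t} (cs.lowerR J (a * b * c)) = a * M b * c ∧
      cs.length (a * M b * c) = cs.length a + cs.length (M b) + cs.length c := by
  have hsub : cs.parabolic {s} ≤ cs.parabolic {s, t} := cs.parabolic_mono (by simp)
  have hsJ : cs.parabolic {s} ≤ cs.parabolic J :=
    cs.parabolic_mono (Set.singleton_subset_iff.mpr D.left_mem_inter.1)
  have hYJ : cs.parabolic (cs.commutant (cs.simple s) \ {s}) ≤ cs.parabolic J :=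
    cs.parabolic_mono fun i hi => (D.inter.symm ▸ hi.1 : i ∈ J ∩ K).1
  have hpK : a * b ∈ cs.parabolic K := mul_mem haK (cs.parabolic_mono D.pair_subset hb)
  have hlp := cs.length_mul_of_mem_minRight ha hb
  set p := a * b with hp
  set q := cs.upperR J p
  set g := cs.lowerR J p
  have hq : q ∈ cs.minRight J := cs.upperR_mem _ _
  have hg : g ∈ cs.parabolic J := cs.lowerR_mem _ _
  have hqg : q * g = p := cs.upperR_mul_lowerR _ _
  have hlqg := cs.length_mul_of_mem_minRight hq hg
  -- `g` is a suffix of `a b ∈ W_K`, hence lies in `W_{J ∩ K} = W_{C_s}`.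
  have hgK : g ∈ cs.parabolic K :=
    BruhatLE.mem_parabolic cs (cs.bruhatLE_mul_left hlqg) (hqg.symm ▸ hpK)
  have hqK : q ∈ cs.parabolic K :=
    BruhatLE.mem_parabolic cs (cs.bruhatLE_mul_right hlqg) (hqg.symm ▸ hpK)
  have hgC := cs.mem_parabolic_inter hg hgK
  rw [D.inter] at hgC
  obtain ⟨y, hy, e, he, hye⟩ := cs.exists_mul_of_mem_parabolic_commutant hgC
  have hcye := cs.commute_commutant hy he
  have hyc : y * c ∈ cs.minLeft {s, t} := by
    intro i hi hd
    have h1 := IsLeftDescent.mem_of_mem_parabolic cs hd (mul_mem (hYJ hy) hc)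
    have his : i = s := by
      by_contra his
      exact D.notMem_pair h1 his hi
    subst his
    exact cs.not_isLeftDescent_commutant_mul hy (hcH i hi) hd
  -- This displays the defining factorization: `q` is the `W^J`-part, `e` the `W_H`-part of the
  -- rest, and `y c` the part minimal for `H`.
  have hu : p * c = q * (e * (y * c)) := by
    rw [← hqg, hye, hcye]
    simp only [mul_assoc]
  have heyc : e * (y * c) ∈ cs.parabolic J := mul_mem (hsJ he) (mul_mem (hYJ hy) hc)
  rw [hu, cs.upperR_mul hq heyc, cs.lowerR_mul hq heyc, cs.lowerL_mul (hsub he) hyc,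
    cs.upperL_mul (hsub he) hyc]
  set a₁ := cs.upperR {s, t} q
  set b₁ := cs.lowerR {s, t} q
  have ha₁ : a₁ ∈ cs.minRight {s, t} := cs.upperR_mem _ _
  have hb₁ : b₁ ∈ cs.parabolic {s, t} := cs.lowerR_mem _ _
  have hq₁ : a₁ * b₁ = q := cs.upperR_mul_lowerR _ _
  have hb₁e := mul_mem hb₁ (hsub he)
  have heq : a₁ * (b₁ * e) * y = p := by
    rw [← mul_assoc, hq₁, ← hqg, hye, hcye, mul_assoc]
  have hey {e' : W} (h : e' ∈ cs.parabolic {s}) :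
      cs.length (e' * y) = cs.length e' + cs.length y := by
    refine cs.length_mul_of_mem_minRight (J := cs.commutant (cs.simple s) \ {s}) ?_ hy
    exact cs.mem_minRight_of_disjoint Set.disjoint_sdiff_right h
  have hlg : cs.length g = cs.length e + cs.length y := by rw [hye, hcye, hey he]
  have hlqe := cs.length_mul_of_mem_minRight hq (hsJ he)
  have hlen₁ : cs.length (a₁ * (b₁ * e) * y) = cs.length (a₁ * (b₁ * e)) + cs.length y := by
    rw [heq, ← mul_assoc, hq₁, hlqe, ← hqg, hlqg, hlg]
    ring
  have hpu : cs.BruhatLE p (p * c) := cs.bruhatLE_mul_right (by rw [hlen, hlp])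
  have hx' : ∀ z ∈ cs.parabolic {s, t}, cs.BruhatLE z (a * b) → cs.BruhatLE z x :=
    fun z hz hzp => hx z hz (hzp.trans hpu)
  have hmap := D.mul_map_of_mul_commutant ha₁ hb₁e ha hb hy heq hlen₁ hx' hadm
  refine ⟨by rw [hmap]; simp only [mul_assoc], ?_⟩
  have hle₁ : cs.BruhatLE (a₁ * (b₁ * e)) p := heq ▸ cs.bruhatLE_mul_right hlen₁
  have hb₁x : cs.BruhatLE (b₁ * e) x := hx' _ hb₁e
    ((cs.bruhatLE_mul_left (cs.length_mul_of_mem_minRight ha₁ hb₁e)).trans hle₁)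
  have ha₁a : cs.BruhatLE a₁ a := by
    have := hle₁.upperR {s, t}
    rwa [cs.upperR_mul ha₁ hb₁e, hp, cs.upperR_mul ha hb] at this
  have ha₁K : a₁ ∈ cs.parabolic K :=
    BruhatLE.mem_parabolic cs (cs.upperR_bruhatLE _ _) hqK
  have hmin := D.mul_upperR_map_mem_minRight ha₁ ha₁K hb₁ (hq₁.symm ▸ hq) he hb₁x
    (hadm.of_le ha₁a)
  set β := cs.upperR {s} (M (b₁ * e))
  set e' := cs.lowerR {s} (M (b₁ * e))
  have he' : e' ∈ cs.parabolic {s} := cs.lowerR_mem _ _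
  have hβe : β * e' = M (b₁ * e) := cs.upperR_mul_lowerR _ _
  have hbx : cs.BruhatLE b x :=
    hx' b hb (cs.bruhatLE_mul_left (cs.length_mul_of_mem_minRight ha hb))
  have h1 := cs.length_mul_of_mem_minRight ha (D.map_mem hbx)
  -- Both `a M(b)` and `a M(b) c` have `W^J`-part `a₁ β`, with `W_J`-parts `e' y` and `e' y c`.
  -- Additivity for `u` gives `ℓ(y c) = ℓ(y) + ℓ(c)`, so the two lengths differ by `ℓ(c)`.
  have e1 : a * M b = a₁ * β * (e' * y) := by rw [hmap, ← hβe]; simp only [mul_assoc]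
  have e2 : a * M b * c = a₁ * β * (e' * (y * c)) := by rw [e1]; simp only [mul_assoc]
  have h2 := cs.length_mul_of_mem_minRight hmin (mul_mem (hsJ he') (hYJ hy))
  have h3 := cs.length_mul_of_mem_minRight hmin (mul_mem (hsJ he') (mul_mem (hYJ hy) hc))
  have h4 := cs.length_mul_of_mem_minLeft (hsub he') hyc
  have h5 := cs.length_mul_of_mem_minLeft (hsub he) hyc
  have h6 := cs.length_mul_of_mem_minRight hq heyc
  have h7 := hey he'
  rw [← hu] at h6
  rw [← e1] at h2
  rw [← e2] at h3
  rw [hqg] at hlqg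
  omega

end IsFirstKindData

/-! ### Coverings inside factorizations, and matchings under inversion. -/

theorem bruhatCov_mul_mul_iff {a b b' c : W}
    (h : cs.length (a * b * c) = cs.length a + cs.length b + cs.length c)
    (h' : cs.length (a * b' * c) = cs.length a + cs.length b' + cs.length c) :
    cs.BruhatCov (a * b * c) (a * b' * c) ↔ cs.BruhatCov b b' := by
  have e : (a * b * c)⁻¹ * (a * b' * c) = c⁻¹ * (b⁻¹ * b') * c⁻¹⁻¹ := by group
  unfold BruhatCov
  rw [e, isReflection_conj_iff, h, h']
  refine and_congr_right fun _ => ?_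
  omega

variable {cs} in
theorem IsMatching.inv {x : W} {M : W → W} (h : cs.IsMatching x M) :
    cs.IsMatching x⁻¹ (fun u => (M u⁻¹)⁻¹) := by
  intro u hu
  rw [← bruhatLE_inv_iff, inv_inv] at hu
  obtain ⟨h1, h2, h3⟩ := h _ hu
  refine ⟨h1.inv, by simp [h2], ?_⟩
  rcases h3 with h3 | h3
  · left; simpa using h3.inv
  · right; simpa using h3.inv

variable {cs} in
theorem CommutesRight.inv {x : W} {M : W → W} {i : B} (h : cs.CommutesRight x M i) :
    cs.CommutesLeft x⁻¹ (fun u => (M u⁻¹)⁻¹) i := by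
  intro u hu hiu
  rw [← bruhatLE_inv_iff, inv_inv] at hu hiu
  rw [mul_inv_rev, inv_simple] at hiu
  simp only [mul_inv_rev, inv_simple]
  rw [h _ hu hiu, mul_inv_rev, inv_simple]

/-! ### Systems for `w`: reduction of both kinds to the rank two data. -/

namespace MSystem

variable {cs} {w : W} (S : cs.MSystem w)

theorem inter_K (S : cs.MSystem w) : S.J ∩ S.K = cs.commutant (S.M 1) :=
  ((complement_spec cs S.commutant_subset S.K).mp rfl).2

theorem exists_map_one : ∃ s ∈ S.H, S.M 1 = cs.simple s := by
  obtain ⟨h1, -, h3⟩ := S.isMatching 1 (cs.one_bruhatLE _)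
  have hl : cs.length (S.M 1) = 1 := by
    rcases h3 with h | h
    · simpa using h.2
    · have := h.2
      rw [length_one] at this
      omega
  obtain ⟨s, hs⟩ := cs.length_eq_one_iff.mp hl
  refine ⟨s, ?_, hs⟩
  rw [← cs.simple_mem_parabolic_iff, ← hs]
  exact BruhatLE.mem_parabolic cs h1 (cs.longestIn_mem _ _)

/-- Here `W_H` has at most the elements `1, s, t, st`, and a matching with `M(1) = s` can send `t`
only to `st`. So in a system with `|H| = 2` the two generators do not commute. -/
theorem isMultiplicationOn_of_commute {x : W} {M : W → W} {s t : B} (hM : cs.IsMatching x M)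
    (hx : x ∈ cs.parabolic {s, t}) (h1 : M 1 = cs.simple s) (hts : t ≠ s) :
    t ∈ cs.commutant (cs.simple s) → cs.IsMultiplicationOn x M := by
  intro ht
  have hst : cs.simple s * cs.simple t = cs.simple t * cs.simple s := ht
  have hcases : ∀ g ∈ cs.parabolic {s, t},
      g = 1 ∨ g = cs.simple s ∨ g = cs.simple t ∨ g = cs.simple s * cs.simple t := by
    intro g hg
    have hsub : ({s, t} : Set B) ⊆ cs.commutant (cs.simple s) := by
      rintro i (rfl | rfl)
      · exact cs.self_mem_commutant i
      · exact ht
    obtain ⟨y, hy, e, he, rfl⟩ := cs.exists_mul_of_mem_parabolic_commutant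
      (cs.parabolic_mono hsub hg)
    have hy' : y ∈ cs.parabolic {s, t} :=
      (Subgroup.mul_mem_cancel_right _ (cs.parabolic_mono (by simp) he)).mp hg
    have hyt : y ∈ cs.parabolic {t} := by
      refine cs.parabolic_mono ?_ (cs.mem_parabolic_inter hy hy')
      rintro i ⟨hi, rfl | rfl⟩
      · exact absurd rfl hi.2
      · rfl
    rcases cs.mem_parabolic_singleton.mp hyt with rfl | rfl <;>
      rcases cs.mem_parabolic_singleton.mp he with rfl | rfl <;> simp [hst]
  have hone := cs.one_bruhatLE x
  have hMs : M (cs.simple s) = 1 := by rw [← h1]; exact (hM 1 hone).2.1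
  have hMt (h : cs.BruhatLE (cs.simple t) x) : M (cs.simple t) = cs.simple s * cs.simple t := by
    obtain ⟨h2, h3, h4⟩ := hM _ h
    rcases hcases _ (BruhatLE.mem_parabolic cs h2 hx) with h5 | h5 | h5 | h5
    · rw [h5, h1] at h3
      exact absurd (cs.simple_injective h3).symm hts
    · rw [h5] at h4
      rcases h4 with h4 | h4 <;> simpa using h4.2
    · rw [h5] at h4
      rcases h4 with h4 | h4 <;> simpa using h4.2
    · exact h5
  refine ⟨s, Or.inl fun u hu => ?_⟩
  rcases hcases _ (BruhatLE.mem_parabolic cs hu hx) with rfl | rfl | rfl | rfl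
  · rw [h1, mul_one]
  · rw [hMs, simple_mul_simple_self]
  · exact hMt hu
  · have h : cs.BruhatLE (cs.simple t) x := by
      refine (cs.bruhatLE_mul_left ?_).trans hu
      rw [cs.length_simple_mul_simple hts.symm, length_simple, length_simple]
    rw [← hMt h, (hM _ h).2.1, hMt h, simple_mul_simple_cancel_left]

theorem exists_generators : ∃ s t, S.H = {s, t} ∧ S.M 1 = cs.simple s ∧
    (t = s ∨ t ∉ cs.commutant (cs.simple s)) := by
  obtain ⟨s, hs, h1⟩ := S.exists_map_one
  rcases S.card_H with h | h
  · obtain ⟨p, hp⟩ := Set.encard_eq_one.mp h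
    rw [hp] at hs
    obtain rfl : s = p := hs
    exact ⟨s, s, by simp [hp], h1, Or.inl rfl⟩
  · have key (t : B) (hts : t ≠ s) (hH : S.H = {s, t}) : t ∉ cs.commutant (cs.simple s) := by
      intro ht
      have hx := cs.longestIn_mem S.H w
      have := S.mult_iff.mp
        (isMultiplicationOn_of_commute S.isMatching (by rwa [hH] at hx ⊢) h1 hts ht)
      rw [this] at h
      norm_num at h
    obtain ⟨p, q, hpq, hH⟩ := Set.encard_eq_two.mp h
    rw [hH] at hs
    rcases hs with rfl | rfl
    · exact ⟨s, q, hH, h1, Or.inr (key q hpq.symm hH)⟩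
    · have hH' := hH.trans (Set.pair_comm p s)
      exact ⟨s, p, hH', h1, Or.inr (key p hpq hH')⟩

theorem isFirstKind_or_isSecondKind : S.IsFirstKind ∨ S.IsSecondKind := by
  obtain ⟨s, t, hH, h1, -⟩ := S.exists_generators
  have hs : s ∈ S.J ∩ S.K := by
    rw [S.inter_K, h1]
    exact cs.self_mem_commutant s
  unfold IsFirstKind IsSecondKind
  rw [hH]
  by_cases ht : t ∈ S.J
  · right
    rintro i (rfl | rfl)
    · exact hs.1
    · exact ht
  · left
    rintro i (rfl | rfl)
    · exact hs.2
    · exact Or.inl ht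

variable {S}

/-- If `t ≠ s`, then `t ∈ J` would put `t` in `J ∩ K = C_s`, which `exists_generators` excludes. -/
theorem IsFirstKind.exists_data (h : S.IsFirstKind) : ∃ s t, S.H = {s, t} ∧
    cs.IsFirstKindData S.J S.K s t (cs.longestIn S.H w) S.M := by
  obtain ⟨s, t, hH, h1, hst⟩ := S.exists_generators
  have hi := S.inter_K
  rw [h1] at hi
  have ht : t ∈ S.K := h (by simp [hH])
  refine ⟨s, t, hH, hi, ht, hst.imp_right fun hn hJ => hn (hi ▸ ⟨hJ, ht⟩), S.isMatching, ?_, h1⟩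
  rw [← hH]
  exact cs.longestIn_mem _ _

theorem IsSecondKind.exists_data (h : S.IsSecondKind) : ∃ s t, S.H = {s, t} ∧
    cs.IsFirstKindData S.K S.J s t (cs.longestIn S.H w)⁻¹ (fun u => (S.M u⁻¹)⁻¹) := by
  obtain ⟨s, t, hH, h1, hst⟩ := S.exists_generators
  have hi := S.inter_K
  rw [h1] at hi
  have ht : t ∈ S.J := h (by simp [hH])
  refine ⟨s, t, hH, by rw [Set.inter_comm, hi], ht,
    hst.imp_right fun hn hK => hn (hi ▸ ⟨ht, hK⟩), S.isMatching.inv, ?_, by simp [h1]⟩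
  rw [← hH]
  exact inv_mem (cs.longestIn_mem _ _)

/-- Guarantees that the elements of `W_H` met below `u` lie in the interval on which `M` is a
matching. -/
theorem bruhatLE_longestIn_of_domain {u : W}
    (hu : cs.BruhatLE u w ∨ cs.BruhatLE (cs.longestIn S.H u) (cs.longestIn S.H w))
    {z : W} (hz : z ∈ cs.parabolic S.H) (hzu : cs.BruhatLE z u) :
    cs.BruhatLE z (cs.longestIn S.H w) := by
  rcases hu with hu | hu
  · exact cs.bruhatLE_longestIn hz (hzu.trans hu)
  · exact (cs.bruhatLE_longestIn hz hzu).trans hu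

theorem IsFactorization.bruhatLE {u a b c : W} (h : S.IsFactorization u a b c) :
    cs.BruhatLE b u := by
  have h1 := cs.length_mul_of_mem_minRight h.a_min h.b_mem
  have h2 := h.length_eq
  rw [h.eq] at h2 ⊢
  exact (cs.bruhatLE_mul_left h1).trans (cs.bruhatLE_mul_right (by rw [h2, h1]))

theorem IsFactorization.map {u a b c : W} (h : S.IsFactorization u a b c)
    (hb : cs.BruhatLE b (cs.longestIn S.H w))
    (hl : cs.length (a * S.M b * c) = cs.length a + cs.length (S.M b) + cs.length c) :
    (cs.BruhatCov u (a * S.M b * c) ↔ cs.BruhatCov b (S.M b)) ∧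
      S.IsFactorization (a * S.M b * c) a (S.M b) c := by
  have hlu := h.length_eq
  rw [h.eq] at hlu ⊢
  exact ⟨cs.bruhatCov_mul_mul_iff hlu hl, rfl, hl, h.a_mem, h.a_min, h.a_card, h.a_comm,
    BruhatLE.mem_parabolic cs (S.isMatching b hb).1 (cs.longestIn_mem _ _), h.c_mem, h.c_min,
    h.c_card, h.c_comm⟩

theorem IsFirstKind.map₁_eq_and_length_eq (hS : S.IsFirstKind) {u a b c : W}
    (hu : cs.BruhatLE u w ∨ cs.BruhatLE (cs.longestIn S.H u) (cs.longestIn S.H w))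
    (h : S.IsFactorization u a b c) :
    S.map₁ u = a * S.M b * c ∧
      cs.length (a * S.M b * c) = cs.length a + cs.length (S.M b) + cs.length c := by
  obtain ⟨s, t, hH, D⟩ := hS.exists_data
  have hlu := h.length_eq
  have hx := fun z (hz : z ∈ cs.parabolic S.H) (hzu : cs.BruhatLE z u) =>
    bruhatLE_longestIn_of_domain hu hz hzu
  have ha := h.a_min
  have hb := h.b_mem
  have hc := h.c_min
  have hadm : cs.IsLeftAdmissible S.H (cs.longestIn S.H w) S.M a := ⟨h.a_card, h.a_comm⟩
  unfold map₁ a₁ b₁ c₁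
  rw [h.eq] at hlu hx ⊢
  generalize cs.longestIn S.H w = x at *
  rw [hH] at *
  exact D.map_eq_and_length_eq ha h.a_mem hadm hb h.c_mem hc hlu hx

/-- The first kind result is applied to `u⁻¹ = c⁻¹ b⁻¹ a⁻¹`, with `J` and `K` exchanged and `M`
conjugated by inversion; commuting with `ρ_β` becomes commuting with `λ_β`. -/
theorem IsSecondKind.map₂_eq_and_length_eq (hS : S.IsSecondKind) {u a b c : W}
    (hu : cs.BruhatLE u w ∨ cs.BruhatLE (cs.longestIn S.H u) (cs.longestIn S.H w))
    (h : S.IsFactorization u a b c) :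
    S.map₂ u = a * S.M b * c ∧
      cs.length (a * S.M b * c) = cs.length a + cs.length (S.M b) + cs.length c := by
  obtain ⟨s, t, hH, D⟩ := hS.exists_data
  have e : c⁻¹ * b⁻¹ * a⁻¹ = u⁻¹ := by rw [h.eq]; group
  have hlu : cs.length (c⁻¹ * b⁻¹ * a⁻¹) =
      cs.length c⁻¹ + cs.length b⁻¹ + cs.length a⁻¹ := by
    rw [e]
    simp only [length_inv]
    have := h.length_eq
    omega
  have hx : ∀ z ∈ cs.parabolic S.H, cs.BruhatLE z (c⁻¹ * b⁻¹ * a⁻¹) →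
      cs.BruhatLE z (cs.longestIn S.H w)⁻¹ := by
    intro z hz hzu
    rw [e] at hzu
    have := bruhatLE_longestIn_of_domain hu (inv_mem hz) (by simpa using hzu.inv)
    simpa using this.inv
  have ha := cs.inv_mem_minLeft_iff.mpr h.a_min
  have hb := inv_mem h.b_mem
  have hc := cs.inv_mem_minRight_iff.mpr h.c_min
  have hadm : cs.IsLeftAdmissible S.H (cs.longestIn S.H w)⁻¹ (fun u => (S.M u⁻¹)⁻¹) c⁻¹ := by
    refine ⟨?_, ?_⟩
    · rw [supp_inv]; exact h.c_card
    · rw [supp_inv]; exact fun i hi => (h.c_comm i hi).inv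
  rw [hH] at ha hb hc hadm hx
  rw [hH] at D
  obtain ⟨h1, h2⟩ := D.map_eq_and_length_eq hc (inv_mem h.c_mem) hadm hb (inv_mem h.a_mem) ha
    hlu hx
  rw [← hH, e] at h1
  constructor
  · have h3 := congrArg (fun x => x⁻¹) h1
    simpa [map₂, a₂, b₂, c₂, upperL, lowerL, mul_assoc] using h3
  · have e2 : c⁻¹ * (S.M b⁻¹⁻¹)⁻¹ * a⁻¹ = (a * S.M b * c)⁻¹ := by rw [inv_inv]; group
    rw [e2] at h2
    simp only [length_inv, inv_inv] at h2
    omega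

end MSystem

end CoxeterSystem

theorem mainTheorem4 {B W : Type*} [Group W] {A : CoxeterMatrix B} (cs : CoxeterSystem A W)
    (w : W) (S : cs.MSystem w) :
    (S.IsFirstKind ∨ S.IsSecondKind) ∧
    (S.IsFirstKind → ∀ u, (cs.BruhatLE u w ∨ u ∈ S.domain₁) →
      ∀ a b c, S.IsFactorization u a b c →
        S.map₁ u = a * S.M b * c ∧
        (∀ a' b' c', S.IsFactorization u a' b' c' → a * S.M b * c = a' * S.M b' * c') ∧
        (cs.BruhatCov u (S.map₁ u) ↔ cs.BruhatCov b (S.M b)) ∧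
        S.IsFactorization (S.map₁ u) a (S.M b) c) ∧
    (S.IsSecondKind → ∀ u, (cs.BruhatLE u w ∨ u ∈ S.domain₂) →
      ∀ a b c, S.IsFactorization u a b c →
        S.map₂ u = a * S.M b * c ∧
        (∀ a' b' c', S.IsFactorization u a' b' c' → a * S.M b * c = a' * S.M b' * c') ∧
        (cs.BruhatCov u (S.map₂ u) ↔ cs.BruhatCov b (S.M b)) ∧
        S.IsFactorization (S.map₂ u) a (S.M b) c) := by
  refine ⟨S.isFirstKind_or_isSecondKind, fun hS u hu a b c h => ?_, fun hS u hu a b c h => ?_⟩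
  · have hu' := hu.imp_right fun h => h.1
    have hb := CoxeterSystem.MSystem.bruhatLE_longestIn_of_domain hu' h.b_mem h.bruhatLE
    obtain ⟨h1, h2⟩ := hS.map₁_eq_and_length_eq hu' h
    refine ⟨h1, fun a' b' c' h' => ?_, ?_⟩
    -- Both products equal `S.map₁ u`, which depends on `u` alone.
    · rw [← h1, (hS.map₁_eq_and_length_eq hu' h').1]
    · rw [h1]
      exact h.map hb h2
  · have hu' := hu.imp_right fun h => h.1
    have hb := CoxeterSystem.MSystem.bruhatLE_longestIn_of_domain hu' h.b_mem h.bruhatLE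
    obtain ⟨h1, h2⟩ := hS.map₂_eq_and_length_eq hu' h
    refine ⟨h1, fun a' b' c' h' => ?_, ?_⟩
    · rw [← h1, (hS.map₂_eq_and_length_eq hu' h').1]
    · rw [h1]
      exact h.map hb h2
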